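/- Let $(\mathcal Y,\mathcal A)$ be a countably generated measurable space and let $(Y_n)_{n\ge 0}$ be a Markov chain on it with transition kernel $P(y,dz)=p(y,z)\,m(dz)$, where $m$ is a $\sigma$-finite measure and $p$ is jointly measurable. Let $\pi$ be a stationary probability for $P$ with an everywhere positive density, also denoted $\pi$, with respect to $m$. Suppose that $P$ is irreducible with respect to a maximal irreducibility measure, aperiodic, and Harris recurrent in the following sense: there are $A\in\mathcal A$, a probability measure $\Gamma$ concentrated on $A$, $\varepsilon\in(0,1)$ and $n\ge1$ such that $P_y(Y_k\in A\text{ i.o.})=1$ for all $y\in\mathcal Y$, and $P^n(y,A')\ge\varepsilon\,\Gamma(A')$ for all $y\in A$, $A'\in\mathcal A$. Let $Y_0\sim\pi$. Let $(\tilde Y_n)_{n\ge0}$ be the time-reversed stationary chain, i.e. the Markov chain with $\tilde Y_0\sim\pi$ and transition density $\tilde p(z,y)=p(y,z)\pi(y)/\pi(z)$ with respect to $m$. Let $(\mathbf M,d)$ be a complete separable metric space, let $F:\mathcal Y\times\mathbf M\to\mathbf M$ be jointly measurable and Lipschitz continuous in the second argument, and let $M_0$ be an $\mathbf M$-valued random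 element independent of $(Y_n)_{n\ge0}$ and of $(\tilde Y_n)_{n\ge0}$. Write $F_n=F(Y_n,\cdot)$, $\tilde F_n=F(\tilde Y_n,\cdot)$ and $l(h)=\sup_{u\ne v}d(h(u),h(v))/d(u,v)$. For $n\ge0$, define the forward iterations $M_n=F_n\circ\cdots\circ F_1(M_0)$ and the backward iterations $\tilde M_n=\tilde F_1\circ\cdots\circ\tilde F_n(M_0)$; for $u\in\mathbf M$ let $M_n^u$ and $\tilde M_n^u$ be the same iterations with $M_0$ replaced by $u$. Suppose that $$\mathbf E\log l(F_1)<0\quad\text{and}\quad \mathbf E\log^+ d(F_1(u_0),u_0)<\infty\ \text{ for some }u_0\in\mathbf M,$$ where $\log 0=-\infty$ and the first expectation is well defined, possibly $-\infty$. Then there is an $\mathbf M$-valued random element $\tilde M_\infty$ such that: (i) $\tilde M_n\to\tilde M_\infty$ a.s., and the limit does not depend on the initial value: almost surely, $\tilde M_n^u\to\tilde M_\infty$ for all $u\in\mathbf M$. (ii) $M_n$ converges in distribution to $\tilde M_\infty$. (iii) The law $\Pi$ of $(\tilde Y_1,\tilde M_\infty)$ is the unique stationary probability of the Markov chain $(Y_n,M_n)_{n\ge0}$,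 whose transition kernel is $\mathbf P((y,u),A\times B)=\int_A \mathbf 1_B(F(z,u))\,P(y,dz)$. (iv) Let $\mathbf P_\Pi$ be the law of the Markov chain $(Y_n,M_n)_{n\ge0}$ with transition kernel $\mathbf P$ and initial law $\Pi$. For every $u\in\mathbf M$ and every bounded continuous $g:\mathbf M\to\mathbb R$, $\mathbf P_\Pi$-almost surely $$\frac1n\sum_{k=1}^n g(M_k)\to \mathbf E\,g(\tilde M_\infty)\quad\text{and}\quad \frac1n\sum_{k=1}^n g(M_k^u)\to \mathbf E\,g(\tilde M_\infty).$$ -/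

import Mathlib

open MeasureTheory ProbabilityTheory Filter Topology
open scoped ENNReal NNReal BoundedContinuousFunction

namespace MIRFS

noncomputable section

/-! ### Markov chains on a general state space -/

/-- The process `X` on `(Ω, Pr)` is a time-homogeneous Markov chain with initial law `μ` and
transition kernel `κ`: `X 0` has law `μ`, and the conditional law of `X (n + 1)` given
`X 0, …, X n` is `κ (X n)`. -/
structure IsMarkovChain {Ω S : Type*} [MeasurableSpace Ω] [MeasurableSpace S]
    (κ : Kernel S S) (μ : Measure S) (Pr : Measure Ω) (X : ℕ → Ω → S) : Prop where
  measurable : ∀ n, Measurable (X n)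
  initial : HasLaw (X 0) μ Pr
  step : ∀ n, HasCondDistrib (X (n + 1)) (fun ω (i : Finset.Iic n) => X i ω)
    (κ.comap (fun h : Finset.Iic n → S => h ⟨n, Finset.mem_Iic.2 le_rfl⟩)
      (measurable_pi_apply _)) Pr

/-- The law on path space `ℕ → S` of the Markov chain with transition kernel `κ` and initial
law `μ` (Ionescu-Tulcea). With `μ = dirac y` this is the law of the chain started at `y`. -/
def chainLaw {S : Type*} [MeasurableSpace S] (κ : Kernel S S) [IsMarkovKernel κ]
    (μ : Measure S) : Measure (ℕ → S) :=
  (μ.map (fun y => fun _ : Finset.Iic 0 => y)).bind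
    (Kernel.traj (X := fun _ => S)
      (fun n => κ.comap (fun h : Finset.Iic n → S => h ⟨n, Finset.mem_Iic.2 le_rfl⟩)
        (measurable_pi_apply _)) 0)

/-- `ψ` is a maximal irreducibility measure for `κ`: it is nonzero, `κ` is `ψ`-irreducible, and
every measure for which `κ` is irreducible is absolutely continuous with respect to `ψ`. -/
structure IsMaximalIrreducibilityMeasure {S : Type*} [MeasurableSpace S]
    (κ : Kernel S S) (ψ : Measure S) : Prop where
  ne_zero : ψ ≠ 0
  irreducible : Kernel.IsIrreducible ψ κ
  maximal : ∀ φ : Measure S, Kernel.IsIrreducible φ κ → φ ≪ ψ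

/-- `D 0, …, D (d - 1)` is a `d`-cycle for `κ`: these sets are measurable and pairwise disjoint,
the chain moves from `D i` to `D (i + 1 mod d)` with probability one, and the union of the `D i`
has full measure under the maximal irreducibility measure `ψ`. -/
structure IsCycle {S : Type*} [MeasurableSpace S] (κ : Kernel S S) (ψ : Measure S)
    (d : ℕ) (D : ZMod d → Set S) : Prop where
  measurableSet : ∀ i, MeasurableSet (D i)
  disjoint : Pairwise fun i j => Disjoint (D i) (D j)
  step : ∀ i, ∀ y ∈ D i, κ y (D (i + 1)) = 1
  full : ψ (⋃ i, D i)ᶜ = 0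

/-- Aperiodicity: there is no cycle of length `d ≥ 2`. -/
def IsAperiodic {S : Type*} [MeasurableSpace S] (κ : Kernel S S) (ψ : Measure S) : Prop :=
  ∀ d : ℕ, 2 ≤ d → ¬ ∃ D : ZMod d → Set S, IsCycle κ ψ d D

/-- Harris recurrence: some measurable set `A` is visited infinitely often with probability one
from every starting point, and a minorization `κⁿ(y, ·) ≥ ε Γ` holds for `y ∈ A`, with a
probability measure `Γ` concentrated on `A`. -/
def IsHarrisRecurrent {S : Type*} [MeasurableSpace S] (κ : Kernel S S) [IsMarkovKernel κ] :
    Prop :=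
  ∃ (A : Set S) (Γ : Measure S) (ε : ℝ),
    MeasurableSet A ∧ IsProbabilityMeasure Γ ∧ Γ A = 1 ∧ 0 < ε ∧ ε < 1 ∧
    (∀ y, chainLaw κ (Measure.dirac y) {x | ∃ᶠ n in atTop, x n ∈ A} = 1) ∧
    ∃ n : ℕ, 1 ≤ n ∧ ∀ y ∈ A, ∀ A' : Set S, MeasurableSet A' →
      ENNReal.ofReal ε * Γ A' ≤ (κ ^ n) y A'

/-- The time-reversed (dual) transition kernel, with density
`p̃ (z, y) = p (y, z) q (y) / q (z)` with respect to `m`, where `p` is the transition density of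
the original chain and `q` the density of its stationary law. -/
def dualKernel {S : Type*} [MeasurableSpace S] (m : Measure S) [SigmaFinite m]
    (p : S → S → ℝ≥0) (q : S → ℝ≥0) : Kernel S S :=
  Kernel.withDensity (Kernel.const S m) (fun z y => ((p y z * q y / q z : ℝ≥0) : ℝ≥0∞))

/-! ### Markovian iterated random functions systems -/

/-- The least Lipschitz constant `l(h) = sup_{u ≠ v} d(h u, h v) / d(u, v)`. -/
def lipConst {M : Type*} [MetricSpace M] (h : M → M) : ℝ≥0∞ :=
  ⨆ (u : M) (v : M) (_ : u ≠ v), edist (h u) (h v) / edist u v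

/-- `E log X < 0` for a `[0, ∞]`-valued random variable `X`, with `log 0 = -∞`: the expectation
`E (log X)⁺ - E (log X)⁻`, which may be `-∞`, is well defined and negative. -/
def NegativeMeanLog {Ω : Type*} [MeasurableSpace Ω] (Pr : Measure Ω) (X : Ω → ℝ≥0∞) : Prop :=
  ∫⁻ ω, (ENNReal.log (X ω)).toENNReal ∂Pr < ∫⁻ ω, (-ENNReal.log (X ω)).toENNReal ∂Pr

/-- A jointly measurable map `F : 𝓨 × M → M`, Lipschitz continuous in its second argument. -/
structure LipschitzSystem (𝓨 M : Type*) [MeasurableSpace 𝓨] [MetricSpace M]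
    [MeasurableSpace M] where
  toFun : 𝓨 → M → M
  measurable' : Measurable (fun z : 𝓨 × M => toFun z.1 z.2)
  lipschitz' : ∀ y, ∃ K : ℝ≥0, LipschitzWith K (toFun y)

namespace LipschitzSystem

variable {𝓨 M : Type*} [MeasurableSpace 𝓨] [MetricSpace M] [MeasurableSpace M]

instance : CoeFun (LipschitzSystem 𝓨 M) (fun _ => 𝓨 → M → M) := ⟨toFun⟩

/-- Forward iterations `F_{n:1}(u) = F_n (F_{n-1} (⋯ F_1 (u)))` with `F_k = F (y k)`. -/
def forward (F : LipschitzSystem 𝓨 M) (y : ℕ → 𝓨) : ℕ → M → M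
  | 0, u => u
  | n + 1, u => F (y (n + 1)) (forward F y n u)

/-- Backward iterations `F_{1:n}(u) = F_1 (F_2 (⋯ F_n (u)))` with `F_k = F (y k)`. -/
def backward (F : LipschitzSystem 𝓨 M) (y : ℕ → 𝓨) : ℕ → M → M
  | 0, u => u
  | n + 1, u => backward F y n (F (y (n + 1)) u)

lemma measurable_graph (F : LipschitzSystem 𝓨 M) :
    Measurable (fun z : 𝓨 × M => (z.1, F z.1 z.2)) :=
  measurable_fst.prodMk F.measurable'

/-- The transition kernel of `(Y n, M n)`: from `(y, u)` draw `z` from `P y` and move to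
`(z, F z u)`. -/
def jointKernel (F : LipschitzSystem 𝓨 M) (P : Kernel 𝓨 𝓨) : Kernel (𝓨 × M) (𝓨 × M) :=
  ((P.comap Prod.fst measurable_fst) ×ₖ (Kernel.deterministic Prod.snd measurable_snd)).map
    (fun z => (z.1, F z.1 z.2))

instance (F : LipschitzSystem 𝓨 M) (P : Kernel 𝓨 𝓨) [IsMarkovKernel P] :
    IsMarkovKernel (F.jointKernel P) :=
  Kernel.IsMarkovKernel.map _ F.measurable_graph

lemma jointKernel_apply_prod (F : LipschitzSystem 𝓨 M) (P : Kernel 𝓨 𝓨) [IsMarkovKernel P]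
    (y : 𝓨) (u : M) {A : Set 𝓨} {B : Set M} (hA : MeasurableSet A) (hB : MeasurableSet B) :
    F.jointKernel P (y, u) (A ×ˢ B) =
      ∫⁻ z in A, B.indicator (fun _ => 1) (F z u) ∂(P y) := by
  have hFu : Measurable (fun z => F z u) := F.measurable'.comp measurable_prodMk_right
  have hs : MeasurableSet ((fun z : 𝓨 × M => (z.1, F z.1 z.2)) ⁻¹' (A ×ˢ B)) :=
    F.measurable_graph (hA.prod hB)
  rw [jointKernel, Kernel.map_apply' _ F.measurable_graph _ (hA.prod hB), Kernel.prod_apply,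
    Kernel.comap_apply, Kernel.deterministic_apply, Measure.prod_dirac,
    Measure.map_apply measurable_prodMk_right hs]
  have : (fun z : 𝓨 => B.indicator (fun _ => (1 : ℝ≥0∞)) (F z u)) =
      ((fun z => F z u) ⁻¹' B).indicator (fun _ => 1) := rfl
  rw [this, lintegral_indicator (hFu hB), setLIntegral_one, Measure.restrict_apply (hFu hB)]
  congr 1
  ext z
  simp [and_comm]

end LipschitzSystem

end

end MIRFS

/-! Time reversal exchanges the two kinds of iteration: for the stationary chain and its dual, `(Y
n, M n)` and `(Yd 1, backward n)` have the same law for each fixed `n`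
(`map_forward_eq_map_backward`). Forward iterations settle only in law, but backward ones converge
pathwise. Passing from `n` to `n + 1` changes only the innermost argument, so consecutive backward
iterates differ by at most a product of `n` Lipschitz constants times one displacement of `u₀`. The
strong law for the logarithms makes the product decay exponentially, and the `log⁺` moment makes the
displacement subexponential (`exists_tendsto_backward`).

Reversal then yields (ii). After reversal the first coordinate `Yd 1` no longer depends on `n`, so
the evolution equation of the joint law passes to the limit although nothing is continuous in the
driving variable; this gives stationarity (`invariant_of_ae_tendsto`). A stationary joint law has
first marginal `π`, and forward iterations along one driving path merge, so the starting point is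
forgotten and the law is unique (`eq_of_invariant_joint`). Uniqueness makes the joint kernel
ergodic, whence the ergodic theorem in (iv); merging carries it over to a fixed start.

The strong law comes from a maximal inequality and a dense class. Irreducibility makes `P` ergodic.
For bounded `g`, the sums of `g - κ g` along the chain are a martingale up to a bounded term, so
their second moments grow linearly and their averages vanish. These coboundaries are dense among
centered functions, because an `L²` function orthogonal to them is the density of an invariant
signed measure, hence constant (`exists_coboundary`). Second moments of sums do not change under
time reversal, so the same coboundaries of `κ` serve the dual chain. -/

namespace MIRFS

/-! ### The maximal ergodic inequality -/

section Maximal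

variable {Ω : Type*}

/-- The maximum of the Birkhoff sums `S_0 = 0, S_1, …, S_n` of `f` along `T`. -/
noncomputable def birkhoffMax (T : Ω → Ω) (f : Ω → ℝ) : ℕ → Ω → ℝ
  | 0, _ => 0
  | n + 1, ω => max 0 (f ω + birkhoffMax T f n (T ω))

variable {T : Ω → Ω} {f : Ω → ℝ}

lemma birkhoffMax_nonneg (n : ℕ) (ω : Ω) : 0 ≤ birkhoffMax T f n ω := by
  cases n with
  | zero => exact le_rfl
  | succ n => exact le_max_left _ _

lemma birkhoffMax_le_succ (n : ℕ) (ω : Ω) :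
    birkhoffMax T f n ω ≤ birkhoffMax T f (n + 1) ω := by
  induction n generalizing ω with
  | zero => exact birkhoffMax_nonneg _ _
  | succ n ih => exact max_le_max le_rfl (by gcongr; exact ih _)

lemma birkhoffSum_le_birkhoffMax (n : ℕ) (ω : Ω) :
    birkhoffSum T f n ω ≤ birkhoffMax T f n ω := by
  induction n generalizing ω with
  | zero => simp [birkhoffMax]
  | succ n ih =>
    rw [birkhoffSum_succ']
    exact le_max_of_le_right (by gcongr; exact ih _)

variable [MeasurableSpace Ω] {μ : Measure Ω}

lemma measurable_birkhoffMax (hT : Measurable T) (hf : Measurable f) (n : ℕ) :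
    Measurable (birkhoffMax T f n) := by
  induction n with
  | zero => exact measurable_const
  | succ n ih => exact measurable_const.max (hf.add (ih.comp hT))

lemma integrable_birkhoffMax [IsFiniteMeasure μ] (hT : MeasurePreserving T μ μ)
    (hf : Integrable f μ) (n : ℕ) : Integrable (birkhoffMax T f n) μ := by
  induction n with
  | zero => exact integrable_zero _ _ _
  | succ n ih =>
    exact (integrable_const (0 : ℝ)).sup (hf.add (hT.integrable_comp_of_integrable ih))

/-- The maximal ergodic theorem. -/
theorem setIntegral_birkhoffMax_nonneg [IsFiniteMeasure μ] (hT : MeasurePreserving T μ μ)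
    (hfm : Measurable f) (hf : Integrable f μ) (n : ℕ) :
    0 ≤ ∫ ω in {ω | 0 < birkhoffMax T f n ω}, f ω ∂μ := by
  have hms : MeasurableSet {ω | 0 < birkhoffMax T f n ω} :=
    measurableSet_lt measurable_const (measurable_birkhoffMax hT.measurable hfm n)
  have hi := integrable_birkhoffMax hT hf n
  have hiT : Integrable (fun ω => birkhoffMax T f n (T ω)) μ := hT.integrable_comp_of_integrable hi
  -- Garsia's argument. By invariance `birkhoffMax n - birkhoffMax n ∘ T` has integral zero. It is
  -- at most `f` where `birkhoffMax n` is positive, because there `birkhoffMax n ≤ birkhoffMax (n +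
  -- 1) = f + birkhoffMax n ∘ T`, and it is at most `0` elsewhere.
  have h0 : ∫ ω, (birkhoffMax T f n ω - birkhoffMax T f n (T ω)) ∂μ = 0 := by
    rw [integral_sub hi hiT, sub_eq_zero]
    conv_lhs => rw [← hT.map_eq]
    exact integral_map hT.measurable.aemeasurable
      (measurable_birkhoffMax hT.measurable hfm n).aestronglyMeasurable
  rw [← integral_indicator hms]
  refine h0.symm.le.trans (integral_mono (hi.sub hiT) (hf.indicator hms) fun ω => ?_)
  by_cases hω : 0 < birkhoffMax T f n ω
  · rw [Set.indicator_of_mem (by exact hω)]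
    have h1 : birkhoffMax T f n ω ≤ max 0 (f ω + birkhoffMax T f n (T ω)) :=
      birkhoffMax_le_succ n ω
    rcases le_max_iff.1 h1 with h | h
    · exact absurd hω (not_lt.2 h)
    · simp only; linarith
  · rw [Set.indicator_of_notMem (by exact hω)]
    have := birkhoffMax_nonneg (T := T) (f := f) n (T ω)
    simp only; linarith [not_lt.1 hω]

/-- The weak-type maximal inequality for ergodic averages. -/
theorem measure_exists_lt_birkhoffSum_le [IsFiniteMeasure μ] (hT : MeasurePreserving T μ μ)
    (hfm : Measurable f) (hf : Integrable f μ) (hf0 : ∀ ω, 0 ≤ f ω) {c : ℝ} (hc : 0 < c) :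
    μ {ω | ∃ n : ℕ, c * n < birkhoffSum T f n ω} ≤ ENNReal.ofReal (c⁻¹ * ∫ ω, f ω ∂μ) := by
  -- With `f` recentered by `c`, the maximal theorem on the increasing sets `E n` reads `c * μ (E n)
  -- ≤ ∫ f` over `E n`.
  set g : Ω → ℝ := fun ω => f ω - c
  have hgm : Measurable g := hfm.sub_const c
  have hg : Integrable g μ := hf.sub (integrable_const c)
  have hsum : ∀ n ω, birkhoffSum T g n ω = birkhoffSum T f n ω - c * n := by
    intro n ω
    simp [birkhoffSum, g, Finset.sum_sub_distrib, mul_comm]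
  set E : ℕ → Set Ω := fun n => {ω | 0 < birkhoffMax T g n ω}
  have hE : ∀ n, MeasurableSet (E n) := fun n =>
    measurableSet_lt measurable_const (measurable_birkhoffMax hT.measurable hgm n)
  have hmono : Monotone E := monotone_nat_of_le_succ fun n ω hω =>
    lt_of_lt_of_le hω (birkhoffMax_le_succ n ω)
  have hsub : {ω | ∃ n : ℕ, c * n < birkhoffSum T f n ω} ⊆ ⋃ n, E n := by
    rintro ω ⟨n, hn⟩
    refine Set.mem_iUnion.2 ⟨n, lt_of_lt_of_le ?_ (birkhoffSum_le_birkhoffMax n ω)⟩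
    rw [hsum]; linarith
  refine (measure_mono hsub).trans ?_
  rw [hmono.measure_iUnion]
  refine iSup_le fun n => ?_
  have h1 := setIntegral_birkhoffMax_nonneg hT hgm hg n
  rw [integral_sub hf.integrableOn (integrable_const c).integrableOn] at h1
  have h2 : ∫ ω in E n, f ω ∂μ ≤ ∫ ω, f ω ∂μ :=
    setIntegral_le_integral hf (Eventually.of_forall hf0)
  simp only [integral_const, smul_eq_mul, measureReal_restrict_apply_univ] at h1
  rw [← ofReal_measureReal]
  refine ENNReal.ofReal_le_ofReal ?_
  rw [inv_mul_eq_div, le_div_iff₀ hc]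
  exact (sub_nonneg.1 h1).trans h2

end Maximal

/-! ### A strong law of large numbers for stationary sequences -/

section StrongLaw

variable {S : Type*} [MeasurableSpace S] {Q : Measure (ℕ → S)} [IsProbabilityMeasure Q]

/-- The left shift on sequences. -/
def shift {S : Type*} (x : ℕ → S) : ℕ → S := fun n => x (n + 1)

lemma measurable_shift : Measurable (shift (S := S)) :=
  measurable_pi_lambda _ fun n => measurable_pi_apply (n + 1)

lemma shift_iterate_apply {S : Type*} (k n : ℕ) (x : ℕ → S) : (shift^[k] x) n = x (n + k) := by
  induction k generalizing x with
  | zero => rfl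
  | succ k ih => rw [Function.iterate_succ_apply, ih, shift, add_assoc]

lemma birkhoffSum_shift {S : Type*} (f : S → ℝ) (n : ℕ) (x : ℕ → S) :
    birkhoffSum shift (fun x => f (x 0)) n x = ∑ k ∈ Finset.range n, f (x k) := by
  simp [birkhoffSum, shift_iterate_apply]

lemma measurable_sum_eval {h : S → ℝ} (hm : Measurable h) (n : ℕ) :
    Measurable (fun x : ℕ → S => ∑ k ∈ Finset.range n, h (x k)) :=
  Finset.measurable_sum _ fun k _ => hm.comp (measurable_pi_apply k)

lemma abs_sum_eval_le {S : Type*} {h : S → ℝ} {C : ℝ} (hC : ∀ s, |h s| ≤ C) (s : Finset ℕ)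
    (x : ℕ → S) : |∑ k ∈ s, h (x k)| ≤ s.card * C := by
  refine (Finset.abs_sum_le_sum_abs _ _).trans ?_
  simpa using Finset.sum_le_card_nsmul s (fun k => |h (x k)|) C fun k _ => hC _

/-- A sequence of bounded variables whose partial sums have second moments of linear growth obeys
the strong law of large numbers. -/
theorem ae_tendsto_average_zero_of_sq {h : S → ℝ} (hm : Measurable h) {C : ℝ}
    (hC : ∀ s, |h s| ≤ C) {D : ℝ}
    (hD : ∀ n : ℕ, ∫ x, (∑ k ∈ Finset.range n, h (x k)) ^ 2 ∂Q ≤ D * (n + 1)) :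
    ∀ᵐ x ∂Q, Tendsto (fun n : ℕ => (n : ℝ)⁻¹ * ∑ k ∈ Finset.range n, h (x k)) atTop (𝓝 0) := by
  set A : ℕ → (ℕ → S) → ℝ := fun n x => ∑ k ∈ Finset.range n, h (x k)
  have hAm : ∀ n, Measurable (A n) := fun n => measurable_sum_eval hm n
  have hAb : ∀ n x, |A n x| ≤ n * C := fun n x => by
    simpa using abs_sum_eval_le hC (Finset.range n) x
  have hD0 : 0 ≤ D := by
    have := hD 0; simpa using this
  -- Along the squares `N = (j + 1) ^ 2` the second moment of the average is at most `D * (N + 1) /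
  -- N ^ 2 ≤ 2 * D / N`, which is summable in `j`; so the squared averages are a.s. summable and
  -- tend to zero.
  set G : ℕ → (ℕ → S) → ℝ≥0∞ := fun j x =>
    ENNReal.ofReal ((A ((j + 1) ^ 2) x / ((j + 1) ^ 2 : ℕ)) ^ 2)
  have hGm : ∀ j, Measurable (G j) := fun j =>
    (((hAm _).div_const _).pow_const 2).ennreal_ofReal
  have hGi : ∀ j, ∫⁻ x, G j x ∂Q ≤ ENNReal.ofReal (2 * D * (1 / ((j : ℝ) + 1) ^ 2)) := by
    intro j
    have hint : Integrable (fun x => (A ((j + 1) ^ 2) x / ((j + 1) ^ 2 : ℕ)) ^ 2) Q := by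
      refine Integrable.of_bound (((hAm _).div_const _).pow_const 2).aestronglyMeasurable
        (C ^ 2) (Eventually.of_forall fun x => ?_)
      rw [Real.norm_eq_abs, abs_pow, abs_div]
      gcongr
      rw [div_le_iff₀ (by positivity)]
      calc |A ((j + 1) ^ 2) x| ≤ ((j + 1) ^ 2 : ℕ) * C := hAb _ x
        _ = _ := by rw [abs_of_nonneg (by positivity), mul_comm]
    rw [← ofReal_integral_eq_lintegral_ofReal hint (Eventually.of_forall fun x => sq_nonneg _)]
    refine ENNReal.ofReal_le_ofReal ?_
    simp_rw [div_pow]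
    rw [integral_div, div_le_iff₀ (by positivity)]
    refine (hD _).trans ?_
    push_cast
    have h1 : (0 : ℝ) < ((j : ℝ) + 1) ^ 2 := by positivity
    have h2 : 2 * D * (1 / ((j : ℝ) + 1) ^ 2) * (((j : ℝ) + 1) ^ 2) ^ 2
        = 2 * D * ((j : ℝ) + 1) ^ 2 := by field_simp
    rw [h2]
    nlinarith [sq_nonneg (j : ℝ), (Nat.cast_nonneg j : (0 : ℝ) ≤ j), mul_nonneg hD0 h1.le]
  have hsum : ∑' j, ∫⁻ x, G j x ∂Q ≠ ∞ := by
    refine ne_top_of_le_ne_top ?_ (ENNReal.tsum_le_tsum hGi)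
    have hs : Summable (fun j : ℕ => 2 * D * (1 / ((j : ℝ) + 1) ^ 2)) := by
      refine Summable.mul_left _ ?_
      have := (summable_nat_add_iff 1).2 (Real.summable_one_div_nat_pow.2 (one_lt_two))
      simpa using this
    rw [← ENNReal.ofReal_tsum_of_nonneg (fun j => by positivity) hs]
    exact ENNReal.ofReal_ne_top
  rw [← lintegral_tsum fun j => (hGm j).aemeasurable] at hsum
  filter_upwards [ae_lt_top (Measurable.tsum hGm) hsum] with x hx
  have h1 : Tendsto (fun j => G j x) atTop (𝓝 0) := ENNReal.tendsto_atTop_zero_of_tsum_ne_top hx.ne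
  have h2 : Tendsto (fun j : ℕ => |A ((j + 1) ^ 2) x / ((j + 1) ^ 2 : ℕ)|) atTop (𝓝 0) := by
    have h3 := (ENNReal.tendsto_toReal ENNReal.zero_ne_top).comp h1
    have h4 := (Real.continuous_sqrt.tendsto 0).comp h3
    simpa [Function.comp_def, G, ENNReal.toReal_ofReal, sq_nonneg, Real.sqrt_sq_eq_abs] using h4
  -- For `j = Nat.sqrt n`, at most `2 * j` terms lie between `j ^ 2` and `n`. Each is bounded by
  -- `C`, and division by `n ≥ j ^ 2` leaves the error `2 * C / j`.
  have h5 : Tendsto (fun j : ℕ => |A (j ^ 2) x / (j ^ 2 : ℕ)| + 2 * C / j) atTop (𝓝 0) := by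
    have h6 : Tendsto (fun j : ℕ => |A (j ^ 2) x / (j ^ 2 : ℕ)|) atTop (𝓝 0) :=
      (tendsto_add_atTop_iff_nat 1).1 h2
    simpa using h6.add (tendsto_const_div_atTop_nhds_zero_nat (2 * C))
  have hsqrt : Tendsto Nat.sqrt atTop atTop :=
    tendsto_atTop.2 fun b => (eventually_ge_atTop (b * b)).mono fun n hn => Nat.le_sqrt.2 hn
  refine squeeze_zero_norm' ?_ (h5.comp hsqrt)
  filter_upwards [eventually_ge_atTop 1] with n hn
  set j := Nat.sqrt n
  have hj1 : 1 ≤ j := Nat.le_sqrt.2 (by simpa using hn)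
  have hjn : j ^ 2 ≤ n := Nat.sqrt_le' n
  have hnj : n ≤ j ^ 2 + 2 * j := by
    have := Nat.sqrt_le_add n
    simp only [j]; rw [sq]; omega
  have hC0 : 0 ≤ C := (abs_nonneg _).trans (hC (x 0))
  have hdiff : |A n x| ≤ |A (j ^ 2) x| + 2 * j * C := by
    have : A n x = A (j ^ 2) x + ∑ k ∈ Finset.Ico (j ^ 2) n, h (x k) :=
      (Finset.sum_range_add_sum_Ico _ hjn).symm
    rw [this]
    refine (abs_add_le _ _).trans ?_
    gcongr
    refine (abs_sum_eval_le hC _ x).trans ?_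
    gcongr
    rw [Nat.card_Ico]
    exact_mod_cast (by omega : n - j ^ 2 ≤ 2 * j)
  have hjpos : (0 : ℝ) < j := by exact_mod_cast hj1
  have hnpos : (0 : ℝ) < n := by exact_mod_cast hn
  have hjn' : (j : ℝ) ^ 2 ≤ n := by exact_mod_cast hjn
  simp only [Function.comp]
  rw [Real.norm_eq_abs, abs_mul, abs_inv, Nat.abs_cast, abs_div]
  push_cast
  rw [abs_of_pos (by positivity : (0 : ℝ) < (j : ℝ) ^ 2)]
  calc (n : ℝ)⁻¹ * |A n x| ≤ ((j : ℝ) ^ 2)⁻¹ * (|A (j ^ 2) x| + 2 * j * C) := by gcongr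
    _ = |A (j ^ 2) x| / (j : ℝ) ^ 2 + 2 * C / j := by field_simp

/-- A strong law of large numbers for stationary sequences: convergence of ergodic averages passes
to `L¹`-limits. -/
theorem ae_tendsto_average (hQ : MeasurePreserving shift Q Q) {f : S → ℝ} (hf : Measurable f)
    (hint : Integrable (fun x => f (x 0)) Q) {c : ℝ}
    (happrox : ∀ ε > 0, ∃ h : S → ℝ, Measurable h ∧ (∃ C, ∀ s, |h s| ≤ C) ∧
      (∃ D : ℝ, ∀ n : ℕ, ∫ x, (∑ k ∈ Finset.range n, h (x k)) ^ 2 ∂Q ≤ D * (n + 1)) ∧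
      ∫ x, |f (x 0) - c - h (x 0)| ∂Q ≤ ε) :
    ∀ᵐ x ∂Q, Tendsto (fun n : ℕ => (n : ℝ)⁻¹ * ∑ k ∈ Finset.range n, f (x k)) atTop (𝓝 c) := by
  have key : ∀ j : ℕ, ∀ᵐ x ∂Q, ∀ᶠ n : ℕ in atTop,
      |(n : ℝ)⁻¹ * ∑ k ∈ Finset.range n, f (x k) - c| ≤ 2 / ((j : ℝ) + 1) := by
    intro j
    set a : ℝ := 1 / ((j : ℝ) + 1) with ha
    have ha0 : 0 < a := by positivity
    rw [ae_iff, ← nonpos_iff_eq_zero]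
    refine ENNReal.le_of_forall_pos_le_add fun ε hε _ => ?_
    -- The `L¹` error `a * ε` is tuned to the maximal inequality at level `a`: the averages of the
    -- remainder ever exceed `a` with probability at most `a⁻¹ * (a * ε) = ε`. As `ε` is arbitrary,
    -- the bad set is null.
    obtain ⟨h, hm, ⟨C, hC⟩, ⟨D, hD⟩, hfh⟩ := happrox (a * ε) (by positivity)
    set r : S → ℝ := fun s => |f s - c - h s|
    have hr : Measurable r := ((hf.sub_const c).sub hm).abs
    have hhi : Integrable (fun x : ℕ → S => h (x 0)) Q :=
      Integrable.of_bound (hm.comp (measurable_pi_apply 0)).aestronglyMeasurable C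
        (Eventually.of_forall fun x => hC _)
    have hri : Integrable (fun x : ℕ → S => r (x 0)) Q :=
      ((hint.sub (integrable_const c)).sub hhi).abs
    have hmax := measure_exists_lt_birkhoffSum_le hQ (hr.comp (measurable_pi_apply 0)) hri
      (fun _ => abs_nonneg _) ha0
    have hzero := ae_tendsto_average_zero_of_sq hm hC hD
    rw [ae_iff] at hzero
    refine (measure_mono ?_).trans ((measure_union_le _ _).trans (add_le_add hzero.le (hmax.trans ?_)))
    · intro x hx
      by_contra hcon
      simp only [Set.mem_union, not_or, Set.mem_ofPred_eq, not_not, not_exists, not_lt] at hcon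
      obtain ⟨hx0, hx1⟩ := hcon
      refine hx ?_
      filter_upwards [(Metric.tendsto_nhds.1 hx0) a ha0, eventually_ge_atTop 1] with n hn hn1
      have hnpos : (0 : ℝ) < n := by exact_mod_cast hn1
      have hx2 := hx1 n
      simp only [Function.comp_def] at hx2
      rw [birkhoffSum_shift] at hx2
      rw [Real.dist_eq, sub_zero] at hn
      have hsplit : (n : ℝ)⁻¹ * ∑ k ∈ Finset.range n, f (x k) - c
          = (n : ℝ)⁻¹ * ∑ k ∈ Finset.range n, h (x k)
            + (n : ℝ)⁻¹ * ∑ k ∈ Finset.range n, (f (x k) - c - h (x k)) := by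
        simp only [Finset.sum_sub_distrib, Finset.sum_const, Finset.card_range, nsmul_eq_mul]
        field_simp
        ring
      rw [hsplit]
      have h3 : |(n : ℝ)⁻¹ * ∑ k ∈ Finset.range n, (f (x k) - c - h (x k))| ≤ a := by
        rw [abs_mul, abs_inv, Nat.abs_cast, inv_mul_le_iff₀ hnpos, mul_comm]
        exact (Finset.abs_sum_le_sum_abs _ _).trans hx2
      have h4 : 2 / ((j : ℝ) + 1) = a + a := by rw [ha]; ring
      rw [h4]
      exact (abs_add_le _ _).trans (add_le_add hn.le h3)
    · rw [← ENNReal.ofReal_coe_nnreal]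
      refine ENNReal.ofReal_le_ofReal ?_
      rw [inv_mul_le_iff₀ ha0]
      exact hfh
  filter_upwards [ae_all_iff.2 key] with x hx
  rw [Metric.tendsto_nhds]
  intro ε hε
  have hlim : Tendsto (fun j : ℕ => 2 / ((j : ℝ) + 1)) atTop (𝓝 0) := by
    have := (tendsto_one_div_add_atTop_nhds_zero_nat (𝕜 := ℝ)).const_mul 2
    simpa [div_eq_mul_inv] using this
  obtain ⟨j, hj⟩ := (hlim.eventually (gt_mem_nhds hε)).exists
  filter_upwards [hx j] with n hn
  exact lt_of_le_of_lt hn hj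

end StrongLaw

/-! ### Markov sequences and their path laws -/

section MarkovSequences

variable {Ω S : Type*} [MeasurableSpace Ω] [MeasurableSpace S]

/-- The path `x` stopped at time `n`. -/
def stopPath {S : Type*} (n : ℕ) (x : ℕ → S) : ℕ → S := fun i => x (min i n)

lemma measurable_stopPath (n : ℕ) : Measurable (stopPath (S := S) n) :=
  measurable_pi_lambda _ fun i => measurable_pi_apply (min i n)

/-- The process `X` is Markov with transition kernel `κ`, whatever its initial law: the Markov
property is stated for functions of the path stopped at time `n` and of the next position. -/
structure IsMarkovSeq (κ : Kernel S S) (Pr : Measure Ω) (X : ℕ → Ω → S) : Prop where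
  measurable : ∀ n, Measurable (X n)
  step : ∀ (n : ℕ) (Φ : (ℕ → S) × S → ℝ≥0∞), Measurable Φ →
    ∫⁻ ω, Φ (stopPath n (fun k => X k ω), X (n + 1) ω) ∂Pr =
      ∫⁻ ω, ∫⁻ z, Φ (stopPath n (fun k => X k ω), z) ∂(κ (X n ω)) ∂Pr

variable {κ : Kernel S S} {Pr : Measure Ω} {X : ℕ → Ω → S} {μ : Measure S}

lemma IsMarkovSeq.measurable_path (h : IsMarkovSeq κ Pr X) : Measurable (fun ω k => X k ω) :=
  measurable_pi_lambda _ h.measurable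

lemma IsMarkovChain.isMarkovSeq [SFinite Pr] [IsSFiniteKernel κ] (h : IsMarkovChain κ μ Pr X) :
    IsMarkovSeq κ Pr X where
  measurable := h.measurable
  step n Φ hΦ := by
    have hhist : Measurable (fun ω (i : Finset.Iic n) => X i ω) :=
      measurable_pi_lambda _ fun i => h.measurable i
    -- The history up to `n` is extended by its last value, which gives exactly the stopped path;
    -- histories of all lengths then live in one space.
    let e : (Finset.Iic n → S) → (ℕ → S) := fun v i => v ⟨min i n, by simp⟩
    have he : Measurable e := measurable_pi_lambda _ fun i => measurable_pi_apply _
    let Ψ : (Finset.Iic n → S) × S → ℝ≥0∞ := fun z => Φ (e z.1, z.2)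
    have hΨ : Measurable Ψ := hΦ.comp ((he.comp measurable_fst).prodMk measurable_snd)
    have h1 : ∫⁻ ω, Ψ (fun i => X i ω, X (n + 1) ω) ∂Pr =
        ∫⁻ ω, ∫⁻ z, Ψ (fun i => X i ω, z) ∂(κ (X n ω)) ∂Pr := by
      rw [← lintegral_map (μ := Pr) (f := Ψ) hΨ (hhist.prodMk (h.measurable (n + 1))),
        (h.step n).map_eq, Measure.lintegral_compProd hΨ, lintegral_map _ hhist]
      · rfl
      · exact Measurable.lintegral_kernel_prod_right' hΨ
    exact h1

/-- The law of the stopped path together with the next position. -/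
lemma IsMarkovSeq.map_stopPath_next [SFinite Pr] [IsSFiniteKernel κ] (h : IsMarkovSeq κ Pr X)
    (n : ℕ) :
    Pr.map (fun ω => (stopPath n (fun k => X k ω), X (n + 1) ω)) =
      (Pr.map (fun ω => stopPath n (fun k => X k ω))) ⊗ₘ
        (κ.comap (fun x : ℕ → S => x n) (measurable_pi_apply n)) := by
  have hm : Measurable (fun ω => stopPath n (fun k => X k ω)) :=
    (measurable_stopPath n).comp h.measurable_path
  refine Measure.ext_of_lintegral _ fun Φ hΦ => ?_
  rw [lintegral_map hΦ (hm.prodMk (h.measurable _)), Measure.lintegral_compProd hΦ,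
    lintegral_map _ hm, h.step n Φ hΦ]
  · simp [stopPath, Kernel.comap_apply]
  · exact Measurable.lintegral_kernel_prod_right' hΦ

/-- The one-step property for functions of the present and the next position. -/
lemma IsMarkovSeq.lintegral_pair (h : IsMarkovSeq κ Pr X) (n : ℕ) {Φ : S × S → ℝ≥0∞}
    (hΦ : Measurable Φ) :
    ∫⁻ ω, Φ (X n ω, X (n + 1) ω) ∂Pr = ∫⁻ ω, ∫⁻ z, Φ (X n ω, z) ∂(κ (X n ω)) ∂Pr := by
  have := h.step n (fun z => Φ (z.1 n, z.2))
    (hΦ.comp (((measurable_pi_apply n).comp measurable_fst).prodMk measurable_snd))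
  simpa [stopPath] using this

lemma IsMarkovSeq.shift (h : IsMarkovSeq κ Pr X) : IsMarkovSeq κ Pr (fun n => X (n + 1)) where
  measurable n := h.measurable (n + 1)
  step n Φ hΦ := by
    have := h.step (n + 1) (fun z => Φ (MIRFS.shift z.1, z.2))
      (hΦ.comp ((measurable_shift.comp measurable_fst).prodMk measurable_snd))
    have h2 : ∀ ω, MIRFS.shift (stopPath (n + 1) (fun k => X k ω))
        = stopPath n (fun k => X (k + 1) ω) := by
      intro ω; ext i; simp [MIRFS.shift, stopPath, Nat.add_min_add_right]
    simpa only [h2] using this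

lemma IsMarkovSeq.map_succ [IsSFiniteKernel κ] (h : IsMarkovSeq κ Pr X) (n : ℕ) :
    Pr.map (X (n + 1)) = (Pr.map (X n)).bind κ := by
  refine Measure.ext_of_lintegral _ fun f hf => ?_
  rw [lintegral_map hf (h.measurable _), Measure.lintegral_bind κ.aemeasurable hf.aemeasurable,
    lintegral_map hf.lintegral_kernel (h.measurable _)]
  exact h.lintegral_pair n (hf.comp measurable_snd)

lemma IsMarkovSeq.map_eq_of_invariant [IsSFiniteKernel κ] (h : IsMarkovSeq κ Pr X)
    (h0 : Pr.map (X 0) = μ) (hinv : Kernel.Invariant κ μ) (n : ℕ) : Pr.map (X n) = μ := by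
  induction n with
  | zero => exact h0
  | succ n ih => rw [h.map_succ, ih, hinv.def]

/-- Laws on path space are determined by product functionals. -/
lemma path_measure_ext {Q Q' : Measure (ℕ → S)} [IsFiniteMeasure Q]
    (h : ∀ (n : ℕ) (f : ℕ → S → ℝ≥0∞), (∀ i, Measurable (f i)) →
      ∫⁻ x, ∏ i ∈ Finset.range (n + 1), f i (x i) ∂Q =
        ∫⁻ x, ∏ i ∈ Finset.range (n + 1), f i (x i) ∂Q') : Q = Q' := by
  classical
  refine ext_of_generate_finite _ (generateFrom_squareCylinders (α := fun _ : ℕ => S)).symm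
    (isPiSystem_squareCylinders (fun _ => MeasurableSpace.isPiSystem_measurableSet)
      fun _ => MeasurableSet.univ) ?_ ?_
  · rintro _ ⟨s, t, ht, rfl⟩
    have ht' : ∀ i, MeasurableSet (t i) := fun i => ht i (Set.mem_univ i)
    have hms : MeasurableSet ((s : Set ℕ).pi t) :=
      MeasurableSet.pi s.countable_toSet fun i _ => ht' i
    -- The indicator of a square cylinder is a product functional: `s.sup id` bounds the coordinates
    -- involved, and those outside `s` get the factor `1`.
    have h1 := h (s.sup id) (fun i => if i ∈ s then (t i).indicator 1 else 1) fun i => by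
      split_ifs
      · exact measurable_one.indicator (ht' i)
      · exact measurable_one
    have h2 : ∀ x : ℕ → S, ∏ i ∈ Finset.range (s.sup id + 1),
        (if i ∈ s then (t i).indicator (1 : S → ℝ≥0∞) else 1) (x i)
          = ((s : Set ℕ).pi t).indicator 1 x := by
      intro x
      by_cases hx : x ∈ (s : Set ℕ).pi t
      · rw [Set.indicator_of_mem hx]
        refine Finset.prod_eq_one fun i _ => ?_
        split_ifs with hi
        · exact Set.indicator_of_mem (hx i hi) _
        · rfl
      · rw [Set.indicator_of_notMem hx]
        simp only [Set.mem_pi, not_forall] at hx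
        obtain ⟨i, hi, hxi⟩ := hx
        refine Finset.prod_eq_zero (i := i) (Finset.mem_range_succ_iff.2 (Finset.le_sup (f := id) hi)) ?_
        rw [if_pos (by exact hi), Set.indicator_of_notMem hxi]
    simp only [h2] at h1
    rwa [lintegral_indicator_one hms, lintegral_indicator_one hms] at h1
  · simpa using h 0 (fun _ _ => 1) fun _ => measurable_const

lemma IsMarkovSeq.lintegral_prod_range (h : IsMarkovSeq κ Pr X) (n : ℕ)
    {f : ℕ → S → ℝ≥0∞} (hf : ∀ i, Measurable (f i)) {g : S → ℝ≥0∞} (hg : Measurable g) :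
    ∫⁻ ω, (∏ i ∈ Finset.range (n + 1), f i (X i ω)) * g (X (n + 1) ω) ∂Pr =
      ∫⁻ ω, (∏ i ∈ Finset.range (n + 1), f i (X i ω)) * ∫⁻ z, g z ∂(κ (X n ω)) ∂Pr := by
  have := h.step n (fun z => (∏ i ∈ Finset.range (n + 1), f i (z.1 i)) * g z.2)
    ((Finset.measurable_prod _ fun i _ =>
      (hf i).comp ((measurable_pi_apply i).comp measurable_fst)).mul (hg.comp measurable_snd))
  have h1 : ∀ ω, ∏ i ∈ Finset.range (n + 1), f i (stopPath n (fun k => X k ω) i)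
      = ∏ i ∈ Finset.range (n + 1), f i (X i ω) := fun ω =>
    Finset.prod_congr rfl fun i hi => by
      simp [stopPath, min_eq_left (Finset.mem_range_succ_iff.1 hi)]
  simp only [h1] at this
  rw [this]
  exact lintegral_congr fun ω => by rw [lintegral_const_mul _ hg]

/-- Integrating out the last position absorbs its factor into the preceding one, so a product
functional loses one coordinate and remains a product functional. This is the induction step for
`IsMarkovSeq.map_path_eq`. -/
lemma IsMarkovSeq.lintegral_prod_merge (h : IsMarkovSeq κ Pr X) (n : ℕ)
    {f : ℕ → S → ℝ≥0∞} (hf : ∀ i, Measurable (f i)) :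
    ∫⁻ ω, ∏ i ∈ Finset.range (n + 1 + 1), f i (X i ω) ∂Pr =
      ∫⁻ ω, ∏ i ∈ Finset.range (n + 1), (if i = n then
        fun s => f n s * ∫⁻ z, f (n + 1) z ∂(κ s) else f i) (X i ω) ∂Pr := by
  simp_rw [Finset.prod_range_succ _ (n + 1)]
  rw [h.lintegral_prod_range n hf (hf _)]
  refine lintegral_congr fun ω => ?_
  rw [Finset.prod_range_succ, Finset.prod_range_succ, if_pos rfl, mul_assoc]
  congr 1
  refine Finset.prod_congr rfl fun i hi => ?_
  rw [if_neg (Finset.mem_range.1 hi).ne]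

/-- The transition kernel and the initial law determine the law of the path. -/
theorem IsMarkovSeq.map_path_eq {Ω' : Type*} [MeasurableSpace Ω'] {Pr' : Measure Ω'}
    {X' : ℕ → Ω' → S} [IsFiniteMeasure Pr] (h : IsMarkovSeq κ Pr X) (h' : IsMarkovSeq κ Pr' X')
    (h0 : Pr.map (X 0) = Pr'.map (X' 0)) :
    Pr.map (fun ω k => X k ω) = Pr'.map (fun ω k => X' k ω) := by
  refine path_measure_ext fun n f hf => ?_
  have hprod : ∀ (n : ℕ) (f : ℕ → S → ℝ≥0∞), (∀ i, Measurable (f i)) →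
      Measurable (fun x : ℕ → S => ∏ i ∈ Finset.range n, f i (x i)) := fun n f hf =>
    Finset.measurable_prod _ fun i _ => (hf i).comp (measurable_pi_apply i)
  rw [lintegral_map (hprod _ f hf) h.measurable_path, lintegral_map (hprod _ f hf) h'.measurable_path]
  induction n generalizing f with
  | zero =>
    simp only [zero_add, Finset.range_one, Finset.prod_singleton]
    rw [← lintegral_map (hf 0) (h.measurable 0), h0, lintegral_map (hf 0) (h'.measurable 0)]
  | succ n ih =>
    rw [h.lintegral_prod_merge n hf, h'.lintegral_prod_merge n hf]
    refine ih _ fun i => ?_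
    split_ifs
    · exact (hf n).mul (hf (n + 1)).lintegral_kernel
    · exact hf i

/-- A Markov sequence whose initial law is invariant is stationary. -/
lemma IsMarkovSeq.measurePreserving_shift [IsFiniteMeasure Pr] [IsSFiniteKernel κ]
    (h : IsMarkovSeq κ Pr X) (hinv : Kernel.Invariant κ (Pr.map (X 0))) :
    MeasurePreserving MIRFS.shift (Pr.map fun ω k => X k ω) (Pr.map fun ω k => X k ω) := by
  refine ⟨measurable_shift, ?_⟩
  rw [Measure.map_map measurable_shift h.measurable_path]
  refine (h.map_path_eq h.shift ?_).symm
  rw [h.map_succ 0, hinv.def]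

end MarkovSequences

/-! ### Time reversal -/

section Reversal

variable {Ω S : Type*} [MeasurableSpace Ω] [MeasurableSpace S]
  {κ κ' : Kernel S S} {π : Measure S}

/-- The kernels `κ` and `κ'` are in duality with respect to `π`. -/
def InDuality (κ κ' : Kernel S S) (π : Measure S) : Prop :=
  ∀ f g : S → ℝ≥0∞, Measurable f → Measurable g →
    ∫⁻ y, f y * ∫⁻ z, g z ∂(κ y) ∂π = ∫⁻ z, g z * ∫⁻ y, f y ∂(κ' z) ∂π

/-- The density with respect to `π` of the last position of a chain weighted by `f` along its
path. -/
noncomputable def weightedDensity (κ' : Kernel S S) (f : ℕ → S → ℝ≥0∞) : ℕ → S → ℝ≥0∞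
  | 0 => f 0
  | n + 1 => fun z => f (n + 1) z * ∫⁻ y, weightedDensity κ' f n y ∂(κ' z)

lemma measurable_weightedDensity {f : ℕ → S → ℝ≥0∞} (hf : ∀ i, Measurable (f i)) (n : ℕ) :
    Measurable (weightedDensity κ' f n) := by
  induction n with
  | zero => exact hf 0
  | succ n ih => exact (hf _).mul ih.lintegral_kernel

variable {Pr : Measure Ω} {Y Yd : ℕ → Ω → S}

/-- At each step duality moves `κ` off the test function and puts `κ'` on the accumulated density.
The free factor `g` at the last position is what lets the induction run. -/
lemma IsMarkovSeq.lintegral_weighted (h : IsMarkovSeq κ Pr Y) (h0 : Pr.map (Y 0) = π)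
    (hdual : InDuality κ κ' π) {f : ℕ → S → ℝ≥0∞} (hf : ∀ i, Measurable (f i)) (n : ℕ)
    {g : S → ℝ≥0∞} (hg : Measurable g) :
    ∫⁻ ω, (∏ i ∈ Finset.range (n + 1), f i (Y i ω)) * g (Y n ω) ∂Pr =
      ∫⁻ y, weightedDensity κ' f n y * g y ∂π := by
  induction n generalizing g with
  | zero =>
    have hm : Measurable (fun y => weightedDensity κ' f 0 y * g y) :=
      (measurable_weightedDensity hf 0).mul hg
    rw [← h0, lintegral_map hm (h.measurable 0)]
    simp [weightedDensity]
  | succ n ih =>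
    have hm : Measurable (fun y => f (n + 1) y * g y) := (hf (n + 1)).mul hg
    simp_rw [Finset.prod_range_succ _ (n + 1), mul_assoc]
    rw [h.lintegral_prod_range n hf hm, ih hm.lintegral_kernel,
      hdual _ _ (measurable_weightedDensity hf n) hm]
    refine lintegral_congr fun z => ?_
    simp only [weightedDensity]
    ring

/-- The weighted density is a nested integral against `κ'`, and the dual chain unrolls one layer per
step; `j` counts the layers already unrolled. -/
lemma IsMarkovSeq.lintegral_weighted_dual (h : IsMarkovSeq κ' Pr Yd) (h0 : Pr.map (Yd 0) = π)
    {f : ℕ → S → ℝ≥0∞} (hf : ∀ i, Measurable (f i)) (n j : ℕ) (hj : j ≤ n) :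
    ∫⁻ ω, (∏ i ∈ Finset.range j, f (n - i) (Yd i ω)) * weightedDensity κ' f (n - j) (Yd j ω) ∂Pr =
      ∫⁻ y, weightedDensity κ' f n y ∂π := by
  induction j with
  | zero =>
    rw [← h0, lintegral_map (measurable_weightedDensity hf n) (h.measurable 0)]
    simp
  | succ j ih =>
    rw [h.lintegral_prod_range j (f := fun i => f (n - i)) (fun i => hf _)
      (measurable_weightedDensity hf _), ← ih (by omega)]
    refine lintegral_congr fun ω => ?_
    obtain ⟨k, hk⟩ : ∃ k, n - j = k + 1 := ⟨n - j - 1, by omega⟩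
    have hk' : n - (j + 1) = k := by omega
    rw [Finset.prod_range_succ, hk, hk', weightedDensity, mul_assoc]

/-- Reversing time turns a stationary chain into the chain with the dual kernel. -/
theorem IsMarkovSeq.lintegral_prod_reverse (h : IsMarkovSeq κ Pr Y) (h0 : Pr.map (Y 0) = π)
    (hd : IsMarkovSeq κ' Pr Yd) (hd0 : Pr.map (Yd 0) = π) (hdual : InDuality κ κ' π)
    {f : ℕ → S → ℝ≥0∞} (hf : ∀ i, Measurable (f i)) (n : ℕ) :
    ∫⁻ ω, ∏ i ∈ Finset.range (n + 1), f i (Y i ω) ∂Pr =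
      ∫⁻ ω, ∏ i ∈ Finset.range (n + 1), f i (Yd (n - i) ω) ∂Pr := by
  have h1 := h.lintegral_weighted h0 hdual hf n (g := fun _ => 1) measurable_const
  have h2 := hd.lintegral_weighted_dual hd0 hf n n le_rfl
  simp only [mul_one] at h1
  rw [h1, ← h2]
  refine lintegral_congr fun ω => ?_
  rw [← Finset.prod_range_reflect (fun i => f i (Yd (n - i) ω)), Finset.prod_range_succ,
    Nat.sub_self, weightedDensity]
  congr 1
  · refine Finset.prod_congr rfl fun i hi => ?_
    have := Finset.mem_range.1 hi
    have e1 : n + 1 - 1 - i = n - i := by omega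
    have e2 : n - (n - i) = i := by omega
    rw [e1, e2]
  · simp

/-- Both paths are frozen after time `n`: on the right, truncated subtraction gives `Yd 0` for all
`i ≥ n`. The reversal formula for the times `0, …, n` therefore decides the whole path law. -/
theorem IsMarkovSeq.map_stopPath_eq_reverse [IsFiniteMeasure Pr]
    (h : IsMarkovSeq κ Pr Y) (h0 : Pr.map (Y 0) = π)
    (hd : IsMarkovSeq κ' Pr Yd) (hd0 : Pr.map (Yd 0) = π) (hdual : InDuality κ κ' π) (n : ℕ) :
    Pr.map (fun ω => stopPath n (fun k => Y k ω)) = Pr.map (fun ω i => Yd (n - i) ω) := by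
  refine path_measure_ext fun N f hf => ?_
  have hprod : Measurable (fun x : ℕ → S => ∏ i ∈ Finset.range (N + 1), f i (x i)) :=
    Finset.measurable_prod _ fun i _ => (hf i).comp (measurable_pi_apply i)
  have hpath_meas : Measurable (fun ω => stopPath n (fun k => Y k ω)) :=
    (measurable_stopPath n).comp h.measurable_path
  rw [lintegral_map hprod hpath_meas,
    lintegral_map hprod (measurable_pi_lambda _ fun i => hd.measurable _)]
  -- All factors at times `k ≥ n` see the same position, so they are gathered into the factor of
  -- index `min k n`.
  set f' : ℕ → S → ℝ≥0∞ := fun i s => ∏ k ∈ Finset.range (N + 1) with min k n = i, f k s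
  have hf' : ∀ i, Measurable (f' i) := fun i => Finset.measurable_prod _ fun k _ => hf k
  have hmaps : ∀ k ∈ Finset.range (N + 1), min k n ∈ Finset.range (n + 1) := fun k _ =>
    Finset.mem_range_succ_iff.2 (min_le_right _ _)
  have key := h.lintegral_prod_reverse h0 hd hd0 hdual hf' n
  convert key using 1
  · refine lintegral_congr fun ω => ?_
    rw [← Finset.prod_fiberwise_of_maps_to hmaps]
    refine Finset.prod_congr rfl fun i _ => Finset.prod_congr rfl fun k hk => ?_
    simp [stopPath, (Finset.mem_filter.1 hk).2]
  · refine lintegral_congr fun ω => ?_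
    rw [← Finset.prod_fiberwise_of_maps_to hmaps]
    refine Finset.prod_congr rfl fun i _ => Finset.prod_congr rfl fun k hk => ?_
    have : n - k = n - i := by rw [← (Finset.mem_filter.1 hk).2]; omega
    simp only [this]

end Reversal

/-! ### Second moments of additive functionals of Markov sequences -/

section SecondMoment

variable {Ω S : Type*} [MeasurableSpace Ω] [MeasurableSpace S] {κ : Kernel S S}
  {Pr : Measure Ω} {X : ℕ → Ω → S}

lemma measurable_integral_kernel [IsSFiniteKernel κ] {g : S → ℝ} (hg : Measurable g) :
    Measurable (fun s => ∫ z, g z ∂(κ s)) :=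
  (hg.stronglyMeasurable.integral_kernel).measurable

lemma abs_integral_kernel_le [IsMarkovKernel κ] {g : S → ℝ} {C : ℝ} (hC : ∀ s, |g s| ≤ C) (s : S) :
    |∫ z, g z ∂(κ s)| ≤ C := by
  simpa using norm_integral_le_of_norm_le_const (μ := κ s) (f := g) (C := C) (Eventually.of_forall hC)

/-- Martingale differences are orthogonal to functions of the past. -/
lemma IsMarkovSeq.integral_mul_sub_eq_zero [IsFiniteMeasure Pr] [IsMarkovKernel κ]
    (h : IsMarkovSeq κ Pr X) (n : ℕ) {Φ : (ℕ → S) → ℝ} (hΦ : Measurable Φ) {B : ℝ}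
    (hB : ∀ x, |Φ x| ≤ B) {g : S → ℝ} (hg : Measurable g) {C : ℝ} (hC : ∀ s, |g s| ≤ C) :
    ∫ ω, Φ (stopPath n (fun k => X k ω)) * (g (X (n + 1) ω) - ∫ z, g z ∂(κ (X n ω))) ∂Pr = 0 := by
  have hm : Measurable (fun ω => stopPath n (fun k => X k ω)) :=
    (measurable_stopPath n).comp h.measurable_path
  have hκg := measurable_integral_kernel (κ := κ) hg
  have bdd : ∀ {u : Ω → ℝ}, Measurable u → (∀ ω, |u ω| ≤ C) →
      Integrable (fun ω => Φ (stopPath n (fun k => X k ω)) * u ω) Pr := fun {u} hu hub =>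
    Integrable.of_bound (C := B * C) ((hΦ.comp hm).mul hu).aestronglyMeasurable
      (Eventually.of_forall fun ω => by
        rw [norm_mul, Real.norm_eq_abs, Real.norm_eq_abs]
        exact mul_le_mul (hB _) (hub ω) (abs_nonneg _)
          ((abs_nonneg _).trans (hB (fun k => X k ω))))
  simp_rw [mul_sub]
  rw [integral_sub (bdd (u := fun ω => g (X (n + 1) ω)) (hg.comp (h.measurable _)) fun ω => hC _)
    (bdd (u := fun ω => ∫ z, g z ∂(κ (X n ω))) (hκg.comp (h.measurable _)) fun ω => abs_integral_kernel_le hC _), sub_eq_zero]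
  have hΨ : Measurable (fun z : (ℕ → S) × S => Φ z.1 * g z.2) :=
    (hΦ.comp measurable_fst).mul (hg.comp measurable_snd)
  have hpair : Measurable (fun ω => (stopPath n (fun k => X k ω), X (n + 1) ω)) :=
    hm.prodMk (h.measurable _)
  have h1 : ∫ ω, Φ (stopPath n (fun k => X k ω)) * g (X (n + 1) ω) ∂Pr =
      ∫ z, Φ z.1 * g z.2 ∂(Pr.map (fun ω => (stopPath n (fun k => X k ω), X (n + 1) ω))) :=
    (integral_map hpair.aemeasurable hΨ.aestronglyMeasurable).symm
  have hfin : IsFiniteMeasure (Pr.map (fun ω => stopPath n (fun k => X k ω))) :=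
    Measure.isFiniteMeasure_map _ _
  rw [h1, h.map_stopPath_next n, Measure.integral_compProd, integral_map hm.aemeasurable]
  · refine integral_congr_ae (Eventually.of_forall fun ω => ?_)
    simp only [Kernel.comap_apply, integral_const_mul]
    simp [stopPath]
  · simp only [Kernel.comap_apply, integral_const_mul]
    exact (hΦ.mul (hκg.comp (measurable_pi_apply n))).aestronglyMeasurable
  · refine Integrable.of_bound (C := B * C) hΨ.aestronglyMeasurable
      (Eventually.of_forall fun z => ?_)
    rw [norm_mul, Real.norm_eq_abs, Real.norm_eq_abs]
    exact mul_le_mul (hB _) (hC _) (abs_nonneg _) ((abs_nonneg _).trans (hB z.1))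

/-- The second moments of the partial sums of `g - κ g`, `g` bounded, grow at most linearly. -/
theorem IsMarkovSeq.integral_sq_sum_le [IsProbabilityMeasure Pr] [IsMarkovKernel κ]
    (h : IsMarkovSeq κ Pr X) {g : S → ℝ} (hg : Measurable g) {C : ℝ} (hC : ∀ s, |g s| ≤ C) (n : ℕ) :
    ∫ ω, (∑ k ∈ Finset.range n, (g (X k ω) - ∫ z, g z ∂(κ (X k ω)))) ^ 2 ∂Pr
      ≤ 8 * C ^ 2 * (n + 1) := by
  have hκg := measurable_integral_kernel (κ := κ) hg
  have hκC := abs_integral_kernel_le (κ := κ) hC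
  set d : S → S → ℝ := fun s t => g t - ∫ z, g z ∂(κ s) with hd
  have hdm : ∀ k, Measurable (fun x : ℕ → S => d (x k) (x (k + 1))) := fun k =>
    (hg.comp (measurable_pi_apply _)).sub (hκg.comp (measurable_pi_apply _))
  have hdb : ∀ s t, |d s t| ≤ 2 * C := fun s t =>
    (abs_sub _ _).trans (by linarith [hC t, hκC s])
  -- The martingale part: its increment `g (X (k + 1)) - κ g (X k)` is orthogonal to the past, while
  -- the sum of `g - κ g` differs from it by the telescoping term `g (X 0) - g (X n)`.
  set Φ : ℕ → (ℕ → S) → ℝ := fun n x => ∑ k ∈ Finset.range n, d (x k) (x (k + 1))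
  have hΦm : ∀ n, Measurable (Φ n) := fun n => Finset.measurable_sum _ fun k _ => hdm k
  have hΦb : ∀ n x, |Φ n x| ≤ n * (2 * C) := fun n x => by
    refine (Finset.abs_sum_le_sum_abs _ _).trans ?_
    simpa using Finset.sum_le_card_nsmul (Finset.range n) _ (2 * C)
      fun k _ => hdb (x k) (x (k + 1))
  have hpath := h.measurable_path
  have hΦpath : ∀ n x, Φ n (stopPath n x) = Φ n x := fun n x =>
    Finset.sum_congr rfl fun k hk => by
      have := Finset.mem_range.1 hk
      simp [stopPath, min_eq_left this.le, min_eq_left (Nat.succ_le_of_lt this)]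
  have hint : ∀ {u : Ω → ℝ} {K : ℝ}, Measurable u → (∀ ω, |u ω| ≤ K) → Integrable u Pr :=
    fun hu hK => Integrable.of_bound hu.aestronglyMeasurable _ (Eventually.of_forall hK)
  have hsqint : ∀ {u : Ω → ℝ} {K : ℝ}, Measurable u → (∀ ω, |u ω| ≤ K) →
      Integrable (fun ω => u ω ^ 2) Pr := fun {u} {K} hu hK =>
    hint (K := K ^ 2) (hu.pow_const 2) fun ω => by rw [abs_pow]; gcongr; exact hK ω
  have hmart : ∀ n : ℕ, ∫ ω, Φ n (fun k => X k ω) ^ 2 ∂Pr ≤ 4 * C ^ 2 * n := by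
    intro n
    induction n with
    | zero => simp [Φ]
    | succ n ih =>
      have horth := h.integral_mul_sub_eq_zero n (hΦm n) (hΦb n) hg hC
      simp only [hΦpath] at horth
      have hsplit : ∀ ω, Φ (n + 1) (fun k => X k ω) ^ 2 = Φ n (fun k => X k ω) ^ 2 +
          (2 * (Φ n (fun k => X k ω) * d (X n ω) (X (n + 1) ω)) + d (X n ω) (X (n + 1) ω) ^ 2) := by
        intro ω
        simp only [Φ, Finset.sum_range_succ]
        ring
      have hdω : Measurable (fun ω => d (X n ω) (X (n + 1) ω)) := (hdm n).comp hpath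
      have hi1 := hsqint (u := fun ω => Φ n (fun k => X k ω)) (K := n * (2 * C)) ((hΦm n).comp hpath)
        fun ω => hΦb n (fun k => X k ω)
      have hi2 := hsqint hdω fun ω => hdb _ _
      have hi3 : Integrable (fun ω => Φ n (fun k => X k ω) * d (X n ω) (X (n + 1) ω)) Pr :=
        hint (K := n * (2 * C) * (2 * C)) (((hΦm n).comp hpath).mul hdω) fun ω => by
          rw [abs_mul]
          exact mul_le_mul (hΦb n (fun k => X k ω)) (hdb _ _) (abs_nonneg _)
            ((abs_nonneg _).trans (hΦb n (fun k => X k ω)))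
      have hd2 : ∫ ω, d (X n ω) (X (n + 1) ω) ^ 2 ∂Pr ≤ 4 * C ^ 2 := by
        have := integral_mono hi2 (integrable_const (4 * C ^ 2)) fun ω => by
          have h1 := sq_le_sq.2 ((hdb (X n ω) (X (n + 1) ω)).trans (le_abs_self _))
          simp only; linarith
        simpa using this
      have hi4 : Integrable (fun ω => 2 * (Φ n (fun k => X k ω) * d (X n ω) (X (n + 1) ω)) +
          d (X n ω) (X (n + 1) ω) ^ 2) Pr := (hi3.const_mul 2).add hi2
      simp_rw [hsplit]
      rw [integral_add hi1 hi4, integral_add (hi3.const_mul 2) hi2,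
        integral_const_mul, horth]
      push_cast
      linarith
  have htel : ∀ ω, ∑ k ∈ Finset.range n, (g (X k ω) - ∫ z, g z ∂(κ (X k ω))) =
      Φ n (fun k => X k ω) + (g (X 0 ω) - g (X n ω)) := by
    intro ω
    rw [← Finset.sum_range_sub' (fun k => g (X k ω)), ← Finset.sum_add_distrib]
    exact Finset.sum_congr rfl fun k _ => by simp only [hd]; ring
  have hb : ∀ ω, (g (X 0 ω) - g (X n ω)) ^ 2 ≤ 4 * C ^ 2 := fun ω => by
    have h1 : |g (X 0 ω) - g (X n ω)| ≤ 2 * C :=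
      (abs_sub _ _).trans (by linarith [hC (X 0 ω), hC (X n ω)])
    have h2 := sq_le_sq.2 (h1.trans (le_abs_self _))
    linarith
  have hi1 := hsqint (u := fun ω => Φ n (fun k => X k ω)) (K := n * (2 * C)) ((hΦm n).comp hpath)
        fun ω => hΦb n (fun k => X k ω)
  -- By `(a + b)² ≤ 2a² + 2b²`, with `4 * C ^ 2 * n` bounding the second moment of the martingale
  -- and `4 * C ^ 2` the square of the telescoping term.
  calc ∫ ω, (∑ k ∈ Finset.range n, (g (X k ω) - ∫ z, g z ∂(κ (X k ω)))) ^ 2 ∂Pr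
      ≤ ∫ ω, (2 * Φ n (fun k => X k ω) ^ 2 + 8 * C ^ 2) ∂Pr := by
        refine integral_mono_of_nonneg (Eventually.of_forall fun ω => sq_nonneg _)
          ((hi1.const_mul 2).add (integrable_const _)) (Eventually.of_forall fun ω => ?_)
        simp only [htel]
        nlinarith [hb ω, sq_nonneg (Φ n (fun k => X k ω) - (g (X 0 ω) - g (X n ω)))]
    _ = 2 * ∫ ω, Φ n (fun k => X k ω) ^ 2 ∂Pr + 8 * C ^ 2 := by
        rw [integral_add (hi1.const_mul 2) (integrable_const _), integral_const_mul]
        simp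
    _ ≤ 8 * C ^ 2 * (n + 1) := by linarith [hmart n]

end SecondMoment

/-! ### Ergodic kernels -/

section ErgodicKernel

variable {S : Type*} [MeasurableSpace S] {κ : Kernel S S} {μ : Measure S}

/-- Sets which the chain does not leave are trivial under `μ`. -/
def IsErgodicKernel (κ : Kernel S S) (μ : Measure S) : Prop :=
  ∀ B : Set S, MeasurableSet B → (∀ᵐ y ∂μ, y ∈ B → κ y B = 1) → μ B = 0 ∨ μ Bᶜ = 0

lemma integral_measureReal_eq_of_invariant [IsMarkovKernel κ]
    (hinv : Kernel.Invariant κ μ) {B : Set S} (hB : MeasurableSet B) :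
    ∫ y, (κ y).real B ∂μ = μ.real B := by
  have h1 : ∫⁻ y, κ y B ∂μ = μ B := by
    rw [← Measure.bind_apply hB κ.aemeasurable, hinv.def]
  simp only [Measure.real]
  rw [integral_toReal (κ.measurable_coe hB).aemeasurable
    (Eventually.of_forall fun y => measure_lt_top _ _), h1]

lemma measurable_kernel_real [IsMarkovKernel κ] {B : Set S} (hB : MeasurableSet B) :
    Measurable (fun y => (κ y).real B) :=
  (κ.measurable_coe hB).ennreal_toReal

/-- For an ergodic kernel, the integrable densities of invariant signed measures are constant. -/
theorem ae_eq_integral_of_invariant_density [IsProbabilityMeasure μ] [IsMarkovKernel κ]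
    (hinv : Kernel.Invariant κ μ) (herg : IsErgodicKernel κ μ) {h : S → ℝ} (hm : Measurable h)
    (hi : Integrable h μ)
    (hadj : ∀ B, MeasurableSet B → ∫ y, h y * (κ y).real B ∂μ = ∫ y in B, h y ∂μ) :
    h =ᵐ[μ] fun _ => ∫ y, h y ∂μ := by
  set c := ∫ y, h y ∂μ with hc
  set u : S → ℝ := fun y => h y - c with hu
  have hui : Integrable u μ := hi.sub (integrable_const c)
  have hu0 : ∫ y, u y ∂μ = 0 := by
    rw [integral_sub hi (integrable_const c)]; simp [hc]
  suffices hz : u =ᵐ[μ] 0 by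
    filter_upwards [hz] with y hy
    exact sub_eq_zero.1 hy
  -- The signed measure with density `u` is invariant. On its positive set `B`, the function `u ·
  -- 1_B - u · κ(·, B)` is nonnegative with integral zero, hence vanishes a.e.; where `u > 0` this
  -- forces `κ(·, B) = 1`, so ergodicity applies to `B`.
  set B : Set S := {y | 0 < u y}
  have hB : MeasurableSet B := measurableSet_lt measurable_const (hm.sub_const c)
  have hbd : ∀ y, ‖(κ y).real B‖ ≤ 1 := fun y => by
    rw [Real.norm_eq_abs, abs_of_nonneg measureReal_nonneg]; exact measureReal_le_one
  have hki : ∀ {v : S → ℝ}, Integrable v μ → Integrable (fun y => v y * (κ y).real B) μ :=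
    fun hv => hv.mul_bdd (measurable_kernel_real hB).aestronglyMeasurable (Eventually.of_forall hbd)
  have hadj' : ∫ y, u y * (κ y).real B ∂μ = ∫ y in B, u y ∂μ := by
    simp only [hu, sub_mul]
    rw [integral_sub (hki hi) (hki (integrable_const c)), hadj B hB, integral_const_mul,
      integral_measureReal_eq_of_invariant hinv hB,
      integral_sub hi.integrableOn (integrable_const c).integrableOn]
    simp [mul_comm]
  have hnn : ∀ y, 0 ≤ B.indicator u y - u y * (κ y).real B := by
    intro y
    have h1 : (κ y).real B ≤ 1 := measureReal_le_one
    have h0 : 0 ≤ (κ y).real B := measureReal_nonneg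
    by_cases hy : y ∈ B
    · rw [Set.indicator_of_mem hy]
      have : 0 < u y := hy
      nlinarith
    · rw [Set.indicator_of_notMem hy]
      have : u y ≤ 0 := not_lt.1 hy
      nlinarith
  have hzero : (fun y => B.indicator u y - u y * (κ y).real B) =ᵐ[μ] 0 := by
    rw [← integral_eq_zero_iff_of_nonneg hnn ((hui.indicator hB).sub (hki hui)),
      integral_sub (hui.indicator hB) (hki hui), integral_indicator hB, hadj', sub_self]
  have hclosed : ∀ᵐ y ∂μ, y ∈ B → κ y B = 1 := by
    filter_upwards [hzero] with y hy hyB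
    have hpos : 0 < u y := hyB
    simp only [Set.indicator_of_mem hyB, Pi.zero_apply] at hy
    have h1 : (κ y).real B = 1 := by
      have : u y * (1 - (κ y).real B) = 0 := by linarith
      rcases mul_eq_zero.1 this with h | h
      · exact absurd h hpos.ne'
      · linarith
    rw [Measure.real, ENNReal.toReal_eq_one_iff] at h1
    exact h1
  -- In either case `u` has a constant sign a.e. and mean zero, so it vanishes a.e.
  rcases herg B hB hclosed with h0 | h0
  · have hle : ∀ᵐ y ∂μ, 0 ≤ -u y := by
      filter_upwards [measure_eq_zero_iff_ae_notMem.1 h0] with y hy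
      exact neg_nonneg.2 (not_lt.1 hy)
    have := (integral_eq_zero_iff_of_nonneg_ae hle hui.neg).1 (by
      rw [integral_neg, hu0, neg_zero])
    filter_upwards [this] with y hy
    simpa using hy
  · have hle : ∀ᵐ y ∂μ, 0 ≤ u y := by
      filter_upwards [measure_eq_zero_iff_ae_notMem.1 h0] with y hy
      have : y ∈ B := by simpa using hy
      exact le_of_lt this
    exact (integral_eq_zero_iff_of_nonneg_ae hle hui).1 hu0

end ErgodicKernel

/-! ### Density of the coboundaries among centered functions -/

section Coboundary

variable {S : Type*} [MeasurableSpace S] {κ : Kernel S S} {μ : Measure S}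

lemma integrable_of_measurable_bounded [IsFiniteMeasure μ] {g : S → ℝ} (hg : Measurable g) {C : ℝ}
    (hC : ∀ s, |g s| ≤ C) : Integrable g μ :=
  Integrable.of_bound hg.aestronglyMeasurable C (Eventually.of_forall hC)

lemma abs_sub_integral_kernel_le [IsMarkovKernel κ] {g : S → ℝ} {C : ℝ} (hC : ∀ s, |g s| ≤ C)
    (s : S) : |g s - ∫ z, g z ∂(κ s)| ≤ 2 * C :=
  (abs_sub _ _).trans (by linarith [hC s, abs_integral_kernel_le (κ := κ) hC s])

lemma measurable_sub_integral_kernel [IsMarkovKernel κ] {g : S → ℝ} (hg : Measurable g) :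
    Measurable (fun s => g s - ∫ z, g z ∂(κ s)) :=
  hg.sub (measurable_integral_kernel hg)

lemma memLp_sub_integral_kernel [IsFiniteMeasure μ] [IsMarkovKernel κ] {g : S → ℝ}
    (hg : Measurable g) {C : ℝ} (hC : ∀ s, |g s| ≤ C) :
    MemLp (fun s => g s - ∫ z, g z ∂(κ s)) 2 μ :=
  MemLp.of_bound (measurable_sub_integral_kernel hg).aestronglyMeasurable (2 * C)
    (Eventually.of_forall (abs_sub_integral_kernel_le hC))

/-- The coboundaries `g - κ g` of bounded measurable functions, as elements of `L²`. -/
def coboundaries (κ : Kernel S S) [IsMarkovKernel κ] (μ : Measure S) :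
    Submodule ℝ (Lp ℝ 2 μ) where
  carrier := {φ | ∃ g : S → ℝ, Measurable g ∧ (∃ C, ∀ s, |g s| ≤ C) ∧
    φ =ᵐ[μ] fun s => g s - ∫ z, g z ∂(κ s)}
  zero_mem' := ⟨0, measurable_zero, ⟨0, by simp⟩, by
    filter_upwards [Lp.coeFn_zero ℝ 2 μ] with s hs
    simpa using hs⟩
  add_mem' := by
    rintro φ φ' ⟨g, hg, ⟨C, hC⟩, h⟩ ⟨g', hg', ⟨C', hC'⟩, h'⟩
    refine ⟨fun s => g s + g' s, hg.add hg', ⟨C + C', fun s =>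
      (abs_add_le _ _).trans (add_le_add (hC s) (hC' s))⟩, ?_⟩
    filter_upwards [Lp.coeFn_add φ φ', h, h'] with s hs h1 h2
    rw [hs, Pi.add_apply, h1, h2, integral_add (integrable_of_measurable_bounded hg hC)
      (integrable_of_measurable_bounded hg' hC')]
    ring
  smul_mem' := by
    rintro c φ ⟨g, hg, ⟨C, hC⟩, h⟩
    refine ⟨fun s => c * g s, hg.const_mul c, ⟨|c| * C, fun s => by
      rw [abs_mul]; gcongr; exact hC s⟩, ?_⟩
    filter_upwards [Lp.coeFn_smul c φ, h] with s hs h1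
    rw [hs, Pi.smul_apply, h1, integral_const_mul, smul_eq_mul]
    ring

lemma integral_indicator_one_kernel [IsMarkovKernel κ] {B : Set S} (hB : MeasurableSet B) (s : S) :
    ∫ z, B.indicator (fun _ => (1 : ℝ)) z ∂(κ s) = (κ s).real B := by
  rw [integral_indicator hB]; simp

/-- Orthogonality to the coboundary of the indicator of `B` says that `∫ u · κ(·, B)` equals the
integral of `u` over `B`: the signed measure with density `u` is invariant. -/
lemma ae_eq_const_of_mem_orthogonal_coboundaries [IsProbabilityMeasure μ] [IsMarkovKernel κ]
    (hinv : Kernel.Invariant κ μ) (herg : IsErgodicKernel κ μ) {u : Lp ℝ 2 μ}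
    (hu : u ∈ (coboundaries κ μ)ᗮ) : u =ᵐ[μ] fun _ => ∫ y, u y ∂μ := by
  have hum : Measurable u := (Lp.stronglyMeasurable u).measurable
  have hui : Integrable u μ := (Lp.memLp u).integrable one_le_two
  refine ae_eq_integral_of_invariant_density hinv herg hum hui fun B hB => ?_
  set g : S → ℝ := B.indicator (fun _ => (1 : ℝ))
  have hg : Measurable g := measurable_const.indicator hB
  have hC : ∀ s, |g s| ≤ 1 := fun s => by
    by_cases hs : s ∈ B <;> simp [g, hs]
  have hL := memLp_sub_integral_kernel (κ := κ) (μ := μ) hg hC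
  have h0 : inner ℝ hL.toLp u = 0 :=
    (Submodule.mem_orthogonal _ _).1 hu _ ⟨g, hg, ⟨1, hC⟩, hL.coeFn_toLp⟩
  rw [L2.inner_def] at h0
  have hki : Integrable (fun y => u y * (κ y).real B) μ :=
    hui.mul_bdd (c := 1) (measurable_kernel_real hB).aestronglyMeasurable
      (Eventually.of_forall fun y => by
        rw [Real.norm_eq_abs, abs_of_nonneg measureReal_nonneg]; exact measureReal_le_one)
  have h1 : ∫ y, (B.indicator u y - u y * (κ y).real B) ∂μ = 0 := by
    rw [← h0]
    refine integral_congr_ae ?_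
    filter_upwards [hL.coeFn_toLp] with y hy
    rw [hy, integral_indicator_one_kernel hB]
    by_cases hyB : y ∈ B
    · simp [g, hyB]; ring
    · simp [g, hyB]
  rw [integral_sub (hui.indicator hB) hki, integral_indicator hB, sub_eq_zero] at h1
  exact h1.symm

/-- Centered square-integrable functions are approximated in `L¹` by coboundaries. -/
lemma exists_coboundary_of_memLp_two [IsProbabilityMeasure μ] [IsMarkovKernel κ]
    (hinv : Kernel.Invariant κ μ) (herg : IsErgodicKernel κ μ) {f : S → ℝ} (hf : MemLp f 2 μ)
    (hf0 : ∫ s, f s ∂μ = 0) {ε : ℝ} (hε : 0 < ε) :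
    ∃ g : S → ℝ, Measurable g ∧ (∃ C, ∀ s, |g s| ≤ C) ∧
      ∫ s, |f s - (g s - ∫ z, g z ∂(κ s))| ∂μ ≤ ε := by
  -- The closure of a subspace is its double orthogonal complement. Functions orthogonal to the
  -- coboundaries are constant, and a centered function is orthogonal to constants.
  have hmem : hf.toLp ∈ (coboundaries κ μ).topologicalClosure := by
    rw [← Submodule.orthogonal_orthogonal_eq_closure, Submodule.mem_orthogonal]
    intro u hu
    have hc := ae_eq_const_of_mem_orthogonal_coboundaries hinv herg hu
    rw [L2.inner_def]
    have : ∀ᵐ s ∂μ, inner ℝ (u s) ((hf.toLp f : Lp ℝ 2 μ) s) = (∫ y, u y ∂μ) * f s := by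
      filter_upwards [hc, hf.coeFn_toLp] with s h1 h2
      rw [h1, h2]; simp [mul_comm]
    rw [integral_congr_ae this, integral_const_mul, hf0, mul_zero]
  obtain ⟨φ, ⟨g, hg, ⟨C, hC⟩, hφ⟩, hd⟩ := Metric.mem_closure_iff.1 hmem ε hε
  refine ⟨g, hg, ⟨C, hC⟩, ?_⟩
  have hL := memLp_sub_integral_kernel (κ := κ) (μ := μ) hg hC
  have hw := hf.sub hL
  have hd2 : (eLpNorm (f - fun s => g s - ∫ z, g z ∂(κ s)) 2 μ).toReal < ε := by
    rw [Lp.dist_def] at hd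
    rwa [eLpNorm_congr_ae (hf.coeFn_toLp.sub hφ)] at hd
  calc ∫ s, |f s - (g s - ∫ z, g z ∂(κ s))| ∂μ
      = (eLpNorm (f - fun s => g s - ∫ z, g z ∂(κ s)) 1 μ).toReal := by
        rw [eLpNorm_one_eq_lintegral_enorm, ← integral_norm_eq_lintegral_enorm hw.1]
        rfl
    _ ≤ (eLpNorm (f - fun s => g s - ∫ z, g z ∂(κ s)) 2 μ).toReal :=
        ENNReal.toReal_mono hw.2.ne (eLpNorm_le_eLpNorm_of_exponent_le one_le_two hw.1)
    _ ≤ ε := hd2.le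

/-- Centered integrable functions are approximated in `L¹` by coboundaries. -/
theorem exists_coboundary [IsProbabilityMeasure μ] [IsMarkovKernel κ]
    (hinv : Kernel.Invariant κ μ) (herg : IsErgodicKernel κ μ) {f : S → ℝ} (hf : Integrable f μ)
    {ε : ℝ} (hε : 0 < ε) :
    ∃ g : S → ℝ, Measurable g ∧ (∃ C, ∀ s, |g s| ≤ C) ∧
      ∫ s, |f s - (∫ t, f t ∂μ) - (g s - ∫ z, g z ∂(κ s))| ∂μ ≤ ε := by
  -- The error is split in three: replacing `f` by a simple function, the resulting change of mean,
  -- and the coboundary approximation of the centered simple function.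
  obtain ⟨φ, hφ, -⟩ := (memLp_one_iff_integrable.2 hf).exists_simpleFunc_eLpNorm_sub_lt
    ENNReal.one_ne_top (ε := ENNReal.ofReal (ε / 3)) (by simpa using hε)
  obtain ⟨K, hK⟩ := φ.exists_forall_norm_le
  have hφi : Integrable φ μ := integrable_of_measurable_bounded φ.measurable hK
  have h1 : ∫ s, |f s - φ s| ∂μ ≤ ε / 3 := by
    rw [eLpNorm_one_eq_lintegral_enorm] at hφ
    have := integral_norm_eq_lintegral_enorm (hf.sub hφi).1
    simp only [Real.norm_eq_abs, Pi.sub_apply] at this hφ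
    rw [this]
    exact ENNReal.toReal_le_of_le_ofReal (by positivity) hφ.le
  have h2 : |∫ t, φ t ∂μ - ∫ t, f t ∂μ| ≤ ε / 3 := by
    rw [abs_sub_comm, ← integral_sub hf hφi]
    exact abs_integral_le_integral_abs.trans h1
  obtain ⟨g, hg, ⟨C, hC⟩, h3⟩ := exists_coboundary_of_memLp_two hinv herg
    (f := fun s => φ s - ∫ t, φ t ∂μ)
    ((MemLp.of_bound φ.measurable.aestronglyMeasurable K (Eventually.of_forall hK)).sub
      (memLp_const _)) (by rw [integral_sub hφi (integrable_const _)]; simp)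
    (ε := ε / 3) (by positivity)
  refine ⟨g, hg, ⟨C, hC⟩, ?_⟩
  have hgi := integrable_of_measurable_bounded (μ := μ) (measurable_sub_integral_kernel (κ := κ) hg)
    (abs_sub_integral_kernel_le hC)
  have i1 : Integrable (fun s => |f s - φ s|) μ := (hf.sub hφi).abs
  have i2 : Integrable (fun s => |φ s - (∫ t, φ t ∂μ) - (g s - ∫ z, g z ∂(κ s))|) μ :=
    ((hφi.sub (integrable_const _)).sub hgi).abs
  calc ∫ s, |f s - (∫ t, f t ∂μ) - (g s - ∫ z, g z ∂(κ s))| ∂μ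
      ≤ ∫ s, (|f s - φ s| + (ε / 3 + |φ s - (∫ t, φ t ∂μ) - (g s - ∫ z, g z ∂(κ s))|)) ∂μ := by
        refine integral_mono_of_nonneg (Eventually.of_forall fun s => abs_nonneg _)
          (i1.add ((integrable_const _).add i2)) (Eventually.of_forall fun s => ?_)
        have hsplit : f s - (∫ t, f t ∂μ) - (g s - ∫ z, g z ∂(κ s)) = (f s - φ s) +
          ((∫ t, φ t ∂μ - ∫ t, f t ∂μ) + (φ s - (∫ t, φ t ∂μ) - (g s - ∫ z, g z ∂(κ s)))) := by
          ring
        simp only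
        rw [hsplit]
        refine (abs_add_le _ _).trans (add_le_add le_rfl ((abs_add_le _ _).trans ?_))
        exact add_le_add h2 le_rfl
    _ = ∫ s, |f s - φ s| ∂μ + (ε / 3 +
          ∫ s, |φ s - (∫ t, φ t ∂μ) - (g s - ∫ z, g z ∂(κ s))| ∂μ) := by
        have i3 : Integrable (fun s => ε / 3 +
            |φ s - (∫ t, φ t ∂μ) - (g s - ∫ z, g z ∂(κ s))|) μ := (integrable_const _).add i2
        rw [integral_add i1 i3, integral_add (integrable_const _) i2]
        simp
    _ ≤ ε := by linarith

end Coboundary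

/-! ### The strong law for ergodic Markov sequences -/

section ChainStrongLaw

variable {Ω S : Type*} [MeasurableSpace Ω] [MeasurableSpace S] {κ : Kernel S S}
  {Pr : Measure Ω} [IsProbabilityMeasure Pr] {X : ℕ → Ω → S} {μ : Measure S}

/-- A stationary sequence for which the partial sums of the coboundaries of an ergodic kernel have
second moments of linear growth obeys the strong law of large numbers. -/
theorem ae_tendsto_average_of_sq_sum_le [IsMarkovKernel κ] [IsProbabilityMeasure μ]
    (hinv : Kernel.Invariant κ μ) (herg : IsErgodicKernel κ μ)
    (hX : ∀ n, Measurable (X n)) (h0 : Pr.map (X 0) = μ)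
    (hstat : MeasurePreserving shift (Pr.map fun ω k => X k ω) (Pr.map fun ω k => X k ω))
    (hsq : ∀ (g : S → ℝ) (C : ℝ), Measurable g → (∀ s, |g s| ≤ C) → ∃ D : ℝ, ∀ n : ℕ,
      ∫ ω, (∑ k ∈ Finset.range n, (g (X k ω) - ∫ z, g z ∂(κ (X k ω)))) ^ 2 ∂Pr ≤ D * (n + 1))
    {f : S → ℝ} (hf : Measurable f) (hint : Integrable f μ) :
    ∀ᵐ ω ∂Pr, Tendsto (fun n : ℕ => (n : ℝ)⁻¹ * ∑ k ∈ Finset.range n, f (X k ω)) atTop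
      (𝓝 (∫ s, f s ∂μ)) := by
  have hpath : Measurable (fun ω k => X k ω) := measurable_pi_lambda _ hX
  have hprob : IsProbabilityMeasure (Pr.map fun ω k => X k ω) :=
    Measure.isProbabilityMeasure_map hpath.aemeasurable
  have heval : (Pr.map fun ω k => X k ω).map (fun x => x 0) = μ := by
    rw [Measure.map_map (measurable_pi_apply 0) hpath, ← h0]; rfl
  refine ae_of_ae_map hpath.aemeasurable (p := fun x => Tendsto (fun n : ℕ => (n : ℝ)⁻¹ *
    ∑ k ∈ Finset.range n, f (x k)) atTop (𝓝 (∫ s, f s ∂μ))) ?_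
  refine ae_tendsto_average hstat hf ?_ fun ε hε => ?_
  · rw [← heval] at hint
    exact hint.comp_measurable (measurable_pi_apply 0)
  -- Here `κ` serves only to produce the dense class; `X` need not be Markov with kernel `κ`. This
  -- makes the argument available for the reversed chain.
  · obtain ⟨g, hg, ⟨C, hC⟩, hgε⟩ := exists_coboundary hinv herg hint hε
    have hm := measurable_sub_integral_kernel (κ := κ) hg
    obtain ⟨D, hD⟩ := hsq g C hg hC
    refine ⟨fun s => g s - ∫ z, g z ∂(κ s), hm, ⟨2 * C, abs_sub_integral_kernel_le hC⟩,
      ⟨D, fun n => ?_⟩, ?_⟩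
    · rw [integral_map hpath.aemeasurable
        ((measurable_sum_eval hm n).pow_const 2).aestronglyMeasurable]
      exact hD n
    · have hw : Measurable (fun s => |f s - (∫ t, f t ∂μ) - (g s - ∫ z, g z ∂(κ s))|) :=
        ((hf.sub_const _).sub hm).abs
      have e := integral_map (μ := Pr.map fun ω k => X k ω) (φ := fun x : ℕ → S => x 0)
        (measurable_pi_apply 0).aemeasurable hw.aestronglyMeasurable
      rw [heval] at e
      exact e.symm.le.trans hgε

theorem IsMarkovSeq.ae_tendsto_average [IsMarkovKernel κ] [IsProbabilityMeasure μ]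
    (h : IsMarkovSeq κ Pr X) (h0 : Pr.map (X 0) = μ)
    (hinv : Kernel.Invariant κ μ) (herg : IsErgodicKernel κ μ)
    {f : S → ℝ} (hf : Measurable f) (hint : Integrable f μ) :
    ∀ᵐ ω ∂Pr, Tendsto (fun n : ℕ => (n : ℝ)⁻¹ * ∑ k ∈ Finset.range n, f (X k ω)) atTop
      (𝓝 (∫ s, f s ∂μ)) :=
  ae_tendsto_average_of_sq_sum_le hinv herg h.measurable h0
    (h.measurePreserving_shift (by rwa [h0])) (fun _ C hg hC =>
      ⟨8 * C ^ 2, fun n => h.integral_sq_sum_le hg hC n⟩) hf hint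

/-- The strong law for the sums over `1, …, n`. -/
theorem IsMarkovSeq.ae_tendsto_average_Icc [IsMarkovKernel κ] [IsProbabilityMeasure μ]
    (h : IsMarkovSeq κ Pr X) (h0 : Pr.map (X 0) = μ)
    (hinv : Kernel.Invariant κ μ) (herg : IsErgodicKernel κ μ)
    {f : S → ℝ} (hf : Measurable f) (hint : Integrable f μ) :
    ∀ᵐ ω ∂Pr, Tendsto (fun n : ℕ => (n : ℝ)⁻¹ * ∑ k ∈ Finset.Icc 1 n, f (X k ω)) atTop
      (𝓝 (∫ s, f s ∂μ)) := by
  filter_upwards [h.shift.ae_tendsto_average (h.map_eq_of_invariant h0 hinv 1) hinv herg hf hint]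
    with ω hω
  simpa only [Finset.range_eq_Ico, Finset.sum_Ico_add' (fun k => f (X k ω)), zero_add,
    Finset.Ico_add_one_right_eq_Icc] using hω

/-- Duality tested with the constant `1` in the second slot, where `κ 1 = 1`. -/
lemma InDuality.invariant {π : Measure S} {κ' : Kernel S S} [IsMarkovKernel κ]
    (hdual : InDuality κ κ' π) : Kernel.Invariant κ' π := by
  refine Measure.ext_of_lintegral _ fun f hf => ?_
  have := hdual f (fun _ => 1) hf measurable_const
  rw [Measure.lintegral_bind κ'.aemeasurable hf.aemeasurable]
  simpa using this.symm

/-- The strong law for the time-reversed chain of an ergodic chain. -/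
theorem IsMarkovSeq.ae_tendsto_average_dual [IsMarkovKernel κ] [IsProbabilityMeasure μ]
    {κ' : Kernel S S} [IsSFiniteKernel κ'] {Xd : ℕ → Ω → S}
    (h : IsMarkovSeq κ Pr X) (h0 : Pr.map (X 0) = μ)
    (hd : IsMarkovSeq κ' Pr Xd) (hd0 : Pr.map (Xd 0) = μ) (hdual : InDuality κ κ' μ)
    (hinv : Kernel.Invariant κ μ) (herg : IsErgodicKernel κ μ)
    {f : S → ℝ} (hf : Measurable f) (hint : Integrable f μ) :
    ∀ᵐ ω ∂Pr, Tendsto (fun n : ℕ => (n : ℝ)⁻¹ * ∑ k ∈ Finset.range n, f (Xd k ω)) atTop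
      (𝓝 (∫ s, f s ∂μ)) := by
  refine ae_tendsto_average_of_sq_sum_le hinv herg hd.measurable hd0
    (hd.measurePreserving_shift (by rw [hd0]; exact hdual.invariant)) (fun g C hg hC =>
      ⟨8 * C ^ 2, fun n => ?_⟩) hf hint
  have hm : Measurable fun x : ℕ → S =>
      (∑ k ∈ Finset.range n, (g (x k) - ∫ z, g z ∂(κ (x k)))) ^ 2 :=
    (measurable_sum_eval (measurable_sub_integral_kernel (κ := κ) hg) n).pow_const 2
  -- Reversal maps the window `0, …, n - 1` onto itself and leaves the sum over it unchanged. So the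
  -- sums of `g - κ g` along the dual chain have the second moments found for the original one; for
  -- `n = 0` both are empty.
  have hrev := h.map_stopPath_eq_reverse h0 hd hd0 hdual (n - 1)
  refine le_trans (le_of_eq ?_) (h.integral_sq_sum_le hg hC n)
  have hpath_meas : Measurable (fun ω => stopPath (n - 1) (fun k => X k ω)) :=
    (measurable_stopPath _).comp h.measurable_path
  have h1 := integral_map (μ := Pr) hpath_meas.aemeasurable hm.aestronglyMeasurable
  have h2 := integral_map (μ := Pr) (φ := fun ω i => Xd (n - 1 - i) ω)
    (measurable_pi_lambda _ fun i => hd.measurable _).aemeasurable hm.aestronglyMeasurable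
  rw [hrev, h2] at h1
  convert h1 using 3 with ω ω
  · rw [Finset.sum_range_reflect (fun k => g (Xd k ω) - ∫ z, g z ∂(κ (Xd k ω)))]
  · congr 1
    refine Finset.sum_congr rfl fun k hk => ?_
    have : min k (n - 1) = k := min_eq_left (by have := Finset.mem_range.1 hk; omega)
    simp [stopPath, this]

end ChainStrongLaw

/-! ### Invariant laws -/

section InvariantLaws

variable {S : Type*} [MeasurableSpace S] {κ : Kernel S S}

lemma chainLaw_eq_trajMeasure [IsMarkovKernel κ] (μ : Measure S) :
    chainLaw κ μ = Kernel.trajMeasure (X := fun _ => S) μ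
      (fun n => κ.comap (fun h : Finset.Iic n → S => h ⟨n, Finset.mem_Iic.2 le_rfl⟩)
        (measurable_pi_apply _)) := by
  have : ⇑(MeasurableEquiv.piUnique (fun _ : Finset.Iic 0 => S)).symm =
      fun (y : S) (_ : Finset.Iic 0) => y := by
    ext y i
    simp [MeasurableEquiv.piUnique]
  rw [chainLaw, Kernel.trajMeasure]
  congr 2

instance [IsMarkovKernel κ] (μ : Measure S) [IsProbabilityMeasure μ] :
    IsProbabilityMeasure (chainLaw κ μ) := by
  rw [chainLaw_eq_trajMeasure]; infer_instance

/-- Under `chainLaw κ μ` the coordinate process is a Markov chain with kernel `κ` and initial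
law `μ`. -/
theorem isMarkovChain_chainLaw [IsMarkovKernel κ] (μ : Measure S) [IsProbabilityMeasure μ] :
    IsMarkovChain κ μ (chainLaw κ μ) (fun n x => x n) where
  measurable n := measurable_pi_apply n
  initial := by
    refine ⟨(measurable_pi_apply 0).aemeasurable, ?_⟩
    have hcomp : (fun x : ℕ → S => x 0) =
        (fun v : Finset.Iic 0 → S => v ⟨0, Finset.mem_Iic.2 le_rfl⟩) ∘
          Preorder.frestrictLe (π := fun _ => S) 0 := rfl
    have hev : Measurable (fun v : Finset.Iic 0 → S => v ⟨0, Finset.mem_Iic.2 le_rfl⟩) :=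
      measurable_pi_apply _
    have hdiag : Measurable (fun (y : S) (_ : Finset.Iic 0) => y) :=
      measurable_pi_lambda _ fun _ => measurable_id
    rw [hcomp, ← Measure.map_map hev (Preorder.measurable_frestrictLe 0),
      chainLaw, Measure.map_comp _ _ (Preorder.measurable_frestrictLe 0),
      Kernel.traj_map_frestrictLe, Kernel.partialTraj_self, Measure.id_comp,
      Measure.map_map hev hdiag]
    exact Measure.map_id
  step n := by
    refine ⟨(Measurable.prodMk (measurable_pi_lambda _ fun i => measurable_pi_apply _)
      (measurable_pi_apply _)).aemeasurable, ?_⟩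
    rw [chainLaw_eq_trajMeasure]
    exact (Kernel.map_frestrictLe_trajMeasure_compProd_eq_map_trajMeasure (X := fun _ => S)
      (μ₀ := μ) (κ := fun n => κ.comap (fun h : Finset.Iic n → S => h ⟨n, Finset.mem_Iic.2 le_rfl⟩)
        (measurable_pi_apply _)) (a := n)).symm

variable {π : Measure S}

/-- The complement of a set which a stationary chain does not leave is not left either. -/
lemma ae_compl_closed [IsFiniteMeasure π] [IsMarkovKernel κ] (hinv : Kernel.Invariant κ π)
    {B : Set S} (hB : MeasurableSet B) (hcl : ∀ᵐ y ∂π, y ∈ B → κ y B = 1) :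
    ∀ᵐ y ∂π, y ∈ Bᶜ → κ y Bᶜ = 1 := by
  -- The flow into `B` has total mass `π B`, and the points of `B` already supply all of it, so
  -- nothing enters from the complement.
  have h1 : ∫⁻ y, κ y B ∂π = π B := by
    rw [← Measure.bind_apply hB κ.aemeasurable, hinv.def]
  have h2 : ∫⁻ y in B, κ y B ∂π = π B := by
    rw [setLIntegral_congr_fun_ae hB (g := fun _ => 1) hcl, setLIntegral_one]
  have h3 : ∫⁻ y in Bᶜ, κ y B ∂π = 0 := by
    rw [← lintegral_add_compl _ hB, h2] at h1
    exact (ENNReal.add_right_inj (measure_ne_top π B)).1 (h1.trans (add_zero _).symm)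
  rw [lintegral_eq_zero_iff (κ.measurable_coe hB)] at h3
  filter_upwards [(ae_restrict_iff' hB.compl).1 h3] with y hy hyB
  rw [prob_compl_eq_one_iff hB]
  exact hy hyB

/-- By invariance a `π`-null set is charged by `κ y` for almost no `y`, so the exceptional set of
the induction hypothesis is harmless after one step. -/
lemma ae_pow_compl_eq_zero [IsMarkovKernel κ] (hinv : Kernel.Invariant κ π)
    {B : Set S} (hB : MeasurableSet B) (hcl : ∀ᵐ y ∂π, y ∈ B → κ y B = 1) (n : ℕ) :
    ∀ᵐ y ∂π, y ∈ B → (κ ^ n) y Bᶜ = 0 := by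
  induction n with
  | zero =>
    refine Eventually.of_forall fun y hy => ?_
    change Kernel.id y Bᶜ = 0
    rw [Kernel.id_apply, Measure.dirac_apply' _ hB.compl]
    simp [hy]
  | succ n ih =>
    have ih' : ∀ᵐ y ∂(π.bind κ), y ∈ B → (κ ^ n) y Bᶜ = 0 := by rwa [hinv.def]
    filter_upwards [Measure.ae_ae_of_ae_comp ih', hcl] with y h1 h2 hy
    rw [add_comm, Kernel.pow_add_apply_eq_lintegral _ _ _ _ hB.compl, pow_one,
      lintegral_eq_zero_iff ((κ ^ n).measurable_coe hB.compl)]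
    have hyB : ∀ᵐ z ∂(κ y), z ∈ B := (prob_compl_eq_zero_iff hB).2 (h2 hy)
    filter_upwards [h1, hyB] with z hz1 hz2 using hz1 hz2

/-- An irreducible kernel is ergodic. -/
theorem isErgodicKernel_of_isIrreducible [IsFiniteMeasure π] [IsMarkovKernel κ]
    (hinv : Kernel.Invariant κ π) {ψ : Measure S} (hψ : ψ ≠ 0) (hirr : Kernel.IsIrreducible ψ κ) :
    IsErgodicKernel κ π := by
  -- From every point of `B` irreducibility reaches `Bᶜ` with positive probability if `ψ Bᶜ > 0`,
  -- whereas almost every point of `B` never leaves it. When `ψ Bᶜ = 0`, the same argument is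
  -- applied to `Bᶜ`, which is closed too and has complement of positive `ψ`-measure.
  have key : ∀ B : Set S, MeasurableSet B → (∀ᵐ y ∂π, y ∈ B → κ y B = 1) → 0 < ψ Bᶜ →
      π B = 0 := by
    intro B hB hcl hpos
    rw [measure_eq_zero_iff_ae_notMem]
    filter_upwards [ae_all_iff.2 (ae_pow_compl_eq_zero hinv hB hcl)] with y hy hyB
    obtain ⟨n, hn⟩ := hirr.irreducible hB.compl hpos y
    exact hn.ne' (hy n hyB)
  intro B hB hcl
  rcases eq_or_ne (ψ Bᶜ) 0 with h0 | h0
  · right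
    refine key Bᶜ hB.compl (ae_compl_closed hinv hB hcl) ?_
    rw [compl_compl, pos_iff_ne_zero]
    intro hB0
    refine hψ (Measure.measure_univ_eq_zero.1 ?_)
    rw [← Set.union_compl_self B]
    exact measure_union_null hB0 h0
  · exact Or.inl (key B hB hcl (pos_iff_ne_zero.2 h0))

/-- An ergodic kernel has no other invariant probability absolutely continuous with respect to a
given one. -/
theorem eq_of_invariant_of_absolutelyContinuous [IsProbabilityMeasure π] [IsMarkovKernel κ]
    (hinv : Kernel.Invariant κ π) (herg : IsErgodicKernel κ π) {ν : Measure S}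
    [IsProbabilityMeasure ν] (hν : Kernel.Invariant κ ν) (hac : ν ≪ π) : ν = π := by
  have hm : Measurable (fun s => (ν.rnDeriv π s).toReal) :=
    (Measure.measurable_rnDeriv ν π).ennreal_toReal
  -- For the density of `ν`, the invariance identity of `ae_eq_integral_of_invariant_density` is
  -- just the invariance of `ν`; the constant is the total mass `1`.
  have h := ae_eq_integral_of_invariant_density hinv herg hm Measure.integrable_toReal_rnDeriv
    fun B hB => by
      rw [Measure.setIntegral_toReal_rnDeriv hac,
        ← integral_measureReal_eq_of_invariant hν hB]
      exact integral_toReal_rnDeriv_mul hac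
  rw [Measure.integral_toReal_rnDeriv hac] at h
  refine (Measure.withDensity_rnDeriv_eq ν π hac).symm.trans
    ((withDensity_congr_ae ?_).trans (withDensity_one (μ := π)))
  filter_upwards [h, Measure.rnDeriv_lt_top ν π] with s hs hs'
  have : (ν.rnDeriv π s).toReal = 1 := by simpa using hs
  rwa [ENNReal.toReal_eq_one_iff] at this

/-- A kernel with a unique invariant probability is ergodic. -/
theorem isErgodicKernel_of_unique [IsProbabilityMeasure π] [IsMarkovKernel κ]
    (hinv : Kernel.Invariant κ π)
    (huniq : ∀ ν : Measure S, IsProbabilityMeasure ν → Kernel.Invariant κ ν → ν = π) :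
    IsErgodicKernel κ π := by
  intro B hB hcl
  by_cases h0 : π B = 0
  · exact Or.inl h0
  right
  have hprob : IsProbabilityMeasure (cond π B) := cond_isProbabilityMeasure h0
  -- Mass started in `B` stays in `B`, so the law conditioned on `B` is mapped below itself; between
  -- probability measures this forces equality. Uniqueness then identifies it with `π`.
  have hle : (cond π B).bind κ ≤ cond π B := by
    refine Measure.le_iff.2 fun C hC => ?_
    rw [Measure.bind_apply hC κ.aemeasurable, cond_apply hB, ProbabilityTheory.cond,
      lintegral_smul_measure, smul_eq_mul]
    gcongr
    calc ∫⁻ y in B, κ y C ∂π = ∫⁻ y in B, κ y (B ∩ C) ∂π := by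
          refine setLIntegral_congr_fun_ae hB ?_
          filter_upwards [hcl] with y hy hyB
          have : κ y Bᶜ = 0 := (prob_compl_eq_zero_iff hB).2 (hy hyB)
          rw [Set.inter_comm, measure_inter_conull this]
      _ ≤ ∫⁻ y, κ y (B ∩ C) ∂π := setLIntegral_le_lintegral _ _
      _ = π (B ∩ C) := by
          rw [← Measure.bind_apply (hB.inter hC) κ.aemeasurable, hinv.def]
  have heq : cond π B = π :=
    huniq _ hprob (Measure.eq_of_le_of_isProbabilityMeasure hle)
  rw [← heq, cond_apply hB]
  simp

end InvariantLaws

/-! ### Kernels with a density -/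

section Density

variable {S : Type*} [MeasurableSpace S] {m : Measure S} {p : S → S → ℝ≥0}
  {q : S → ℝ≥0} {π : Measure S} {P : Kernel S S}

/-- Every invariant law of a kernel with a density is absolutely continuous with respect to a law
with positive density. -/
lemma absolutelyContinuous_of_invariant
    (hPp : ∀ y, P y = m.withDensity (fun z => (p y z : ℝ≥0∞)))
    (hq : Measurable q) (hq_pos : ∀ y, 0 < q y)
    (hπq : π = m.withDensity (fun y => (q y : ℝ≥0∞))) {ν : Measure S}
    (hν : Kernel.Invariant P ν) : ν ≪ π := by
  have hmπ : m ≪ π := by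
    rw [hπq]
    exact withDensity_absolutelyContinuous' hq.coe_nnreal_ennreal.aemeasurable
      (Eventually.of_forall fun y => by simpa using (hq_pos y).ne')
  refine Measure.AbsolutelyContinuous.mk fun A hA hA0 => ?_
  rw [← hν.def, Measure.bind_apply hA P.aemeasurable, lintegral_eq_zero_iff (P.measurable_coe hA)]
  refine Eventually.of_forall fun y => ?_
  change P y A = 0
  rw [hPp y]
  exact withDensity_absolutelyContinuous m _ (hmπ hA0)

lemma measurable_dual_density (hp : Measurable (Function.uncurry p)) (hq : Measurable q) :
    Measurable (Function.uncurry fun z y => ((p y z * q y / q z : ℝ≥0) : ℝ≥0∞)) :=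
  (((hp.comp measurable_swap).mul (hq.comp measurable_snd)).div
    (hq.comp measurable_fst)).coe_nnreal_ennreal

variable [SigmaFinite m]

instance : IsSFiniteKernel (dualKernel m p q) :=
  Kernel.IsSFiniteKernel.withDensity _ fun _ _ => ENNReal.coe_ne_top

/-- The dual kernel is in duality with the original one. -/
theorem inDuality_dualKernel (hp : Measurable (Function.uncurry p))
    (hPp : ∀ y, P y = m.withDensity (fun z => (p y z : ℝ≥0∞)))
    (hq : Measurable q) (hq_pos : ∀ y, 0 < q y)
    (hπq : π = m.withDensity (fun y => (q y : ℝ≥0∞))) : InDuality P (dualKernel m p q) π := by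
  intro f g hf hg
  have hpE : Measurable (fun z : S × S => (p z.1 z.2 : ℝ≥0∞)) := hp.coe_nnreal_ennreal
  have hqE : Measurable (fun y => (q y : ℝ≥0∞)) := hq.coe_nnreal_ennreal
  have hPg : ∀ y, ∫⁻ z, g z ∂(P y) = ∫⁻ z, p y z * g z ∂m := fun y => by
    have hpy : Measurable (fun z => (p y z : ℝ≥0∞)) := hpE.comp measurable_prodMk_left
    rw [hPp y, lintegral_withDensity_eq_lintegral_mul _ hpy hg]
    rfl
  have hDf : ∀ z, ∫⁻ y, f y ∂(dualKernel m p q z) =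
      ∫⁻ y, ((p y z * q y / q z : ℝ≥0) : ℝ≥0∞) * f y ∂m := fun z => by
    rw [dualKernel, Kernel.lintegral_withDensity _ (measurable_dual_density hp hq) _ hf]
    rfl
  simp only [hPg, hDf]
  have hm1 : Measurable fun z : S × S => (p z.1 z.2 : ℝ≥0∞) * g z.2 :=
    hpE.mul (hg.comp measurable_snd)
  have hm2 : Measurable fun z : S × S => ((p z.2 z.1 * q z.2 / q z.1 : ℝ≥0) : ℝ≥0∞) * f z.2 :=
    (measurable_dual_density hp hq).mul (hf.comp measurable_snd)
  have e1 : ∫⁻ y, f y * ∫⁻ z, p y z * g z ∂m ∂π =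
      ∫⁻ y, ∫⁻ z, q y * f y * (p y z * g z) ∂m ∂m := by
    have hi : Measurable fun y => f y * ∫⁻ z, p y z * g z ∂m :=
      hf.mul hm1.lintegral_prod_right'
    rw [hπq, lintegral_withDensity_eq_lintegral_mul _ hqE hi]
    refine lintegral_congr fun y => ?_
    rw [lintegral_const_mul _ (by exact hm1.comp measurable_prodMk_left), mul_assoc]
    rfl
  have e2 : ∫⁻ z, g z * ∫⁻ y, ((p y z * q y / q z : ℝ≥0) : ℝ≥0∞) * f y ∂m ∂π =
      ∫⁻ z, ∫⁻ y, q z * g z * (((p y z * q y / q z : ℝ≥0) : ℝ≥0∞) * f y) ∂m ∂m := by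
    have hi : Measurable fun z => g z * ∫⁻ y, ((p y z * q y / q z : ℝ≥0) : ℝ≥0∞) * f y ∂m :=
      hg.mul hm2.lintegral_prod_right'
    rw [hπq, lintegral_withDensity_eq_lintegral_mul _ hqE hi]
    refine lintegral_congr fun z => ?_
    rw [lintegral_const_mul _ (by exact hm2.comp measurable_prodMk_left), mul_assoc]
    rfl
  rw [e1, e2, lintegral_lintegral_swap]
  · refine lintegral_congr fun z => lintegral_congr fun y => ?_
    -- After Tonelli the two integrands agree by this identity, which needs `q z` to be nonzero.
    have hz : (q z : ℝ≥0∞) * ((p y z * q y / q z : ℝ≥0) : ℝ≥0∞) = p y z * q y := by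
      rw [← ENNReal.coe_mul, mul_div_cancel₀ _ (hq_pos z).ne', ENNReal.coe_mul]
    calc (q y : ℝ≥0∞) * f y * (p y z * g z) = (p y z * q y) * (f y * g z) := by ring
      _ = (q z * ((p y z * q y / q z : ℝ≥0) : ℝ≥0∞)) * (f y * g z) := by rw [hz]
      _ = _ := by ring
  · exact (((hqE.comp measurable_fst).mul (hf.comp measurable_fst)).mul hm1).aemeasurable

end Density

/-! ### Least Lipschitz constants -/

section LipConst

variable {M : Type*} [MetricSpace M]

lemma lipConst_le_iff {h : M → M} {c : ℝ≥0∞} :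
    lipConst h ≤ c ↔ ∀ u v, edist (h u) (h v) ≤ c * edist u v := by
  simp only [lipConst, iSup_le_iff]
  refine forall₂_congr fun u v => ⟨fun H => ?_, fun H huv => ?_⟩
  · rcases eq_or_ne u v with rfl | huv
    · simp
    · exact (ENNReal.div_le_iff (by simpa using huv) (edist_ne_top _ _)).1 (H huv)
  · exact (ENNReal.div_le_iff (by simpa using huv) (edist_ne_top _ _)).2 H

variable {𝓨 : Type*} [MeasurableSpace 𝓨] [MeasurableSpace M] (F : LipschitzSystem 𝓨 M)

lemma lipConst_lt_top (y : 𝓨) : lipConst (F y) < ∞ := by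
  obtain ⟨K, hK⟩ := F.lipschitz' y
  exact lt_of_le_of_lt (lipConst_le_iff.2 fun u v => hK u v) ENNReal.coe_lt_top

lemma LipschitzSystem.continuous (y : 𝓨) : Continuous (F y) := by
  obtain ⟨K, hK⟩ := F.lipschitz' y
  exact hK.continuous

lemma dist_le_lipConst_mul (y : 𝓨) (u v : M) :
    dist (F y u) (F y v) ≤ (lipConst (F y)).toReal * dist u v := by
  rw [dist_edist, dist_edist, ← ENNReal.toReal_mul]
  exact ENNReal.toReal_mono
    (ENNReal.mul_ne_top (lipConst_lt_top F y).ne (edist_ne_top _ _)) (lipConst_le_iff.1 le_rfl u v)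

variable [BorelSpace M] [TopologicalSpace.SeparableSpace M]

/-- Since each `F y` is continuous, a Lipschitz bound has to be checked only on pairs from a
countable dense sequence. -/
lemma measurable_lipConst : Measurable (fun y => lipConst (F y)) := by
  rcases isEmpty_or_nonempty M with hM | hM
  · have : (fun y => lipConst (F y)) = fun _ => 0 := by
      ext y; exact le_antisymm (lipConst_le_iff.2 fun u => hM.elim u) zero_le
    rw [this]; exact measurable_const
  have : SecondCountableTopology M := UniformSpace.secondCountable_of_separable M
  refine measurable_of_Iic fun c => ?_
  -- The value `∞` is treated apart because multiplication by it is not continuous on `ℝ≥0∞`.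
  rcases eq_or_ne c ∞ with rfl | hc
  · simp
  set d := TopologicalSpace.denseSeq M
  have hset : (fun y => lipConst (F y)) ⁻¹' Set.Iic c =
      ⋂ (i : ℕ) (j : ℕ), {y | edist (F y (d i)) (F y (d j)) ≤ c * edist (d i) (d j)} := by
    ext y
    simp only [Set.mem_preimage, Set.mem_Iic, Set.mem_iInter, lipConst_le_iff]
    refine ⟨fun H i j => H _ _, fun H u v => ?_⟩
    have hcl : IsClosed {z : M × M | edist (F y z.1) (F y z.2) ≤ c * edist z.1 z.2} :=
      isClosed_le (((F.continuous y).comp continuous_fst).edist ((F.continuous y).comp continuous_snd))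
        ((ENNReal.continuous_const_mul hc).comp continuous_edist)
    have hdense : DenseRange (Prod.map d d) :=
      (TopologicalSpace.denseRange_denseSeq M).prodMap (TopologicalSpace.denseRange_denseSeq M)
    exact hdense.induction_on (p := fun z : M × M => edist (F y z.1) (F y z.2) ≤ c * edist z.1 z.2)
      (u, v) hcl fun z => H z.1 z.2
  rw [hset]
  exact MeasurableSet.iInter fun i => MeasurableSet.iInter fun j =>
    measurableSet_le ((F.measurable'.comp measurable_prodMk_right).edist
      (F.measurable'.comp measurable_prodMk_right)) measurable_const

end LipConst

/-! ### Truncation of the logarithm -/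

lemma toENNReal_log_eq_ofReal {x : ℝ≥0∞} (hx : x < ∞) :
    (ENNReal.log x).toENNReal = ENNReal.ofReal (Real.log (max x.toReal 1)) := by
  rcases eq_or_ne x 0 with rfl | h0
  · simp
  rw [ENNReal.log_pos_real h0 hx.ne, EReal.toENNReal_of_ne_top (EReal.coe_ne_top _),
    EReal.toReal_coe]
  rcases le_total x.toReal 1 with h | h
  · rw [max_eq_right h, Real.log_one, ENNReal.ofReal_of_nonpos
      (Real.log_nonpos ENNReal.toReal_nonneg h), ENNReal.ofReal_zero]
  · rw [max_eq_left h]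

/-- Capping the negative part of the logarithm at `K` amounts to raising `x` to at least `exp (-K)`;
this also covers `x = 0`. -/
lemma min_toENNReal_neg_log_eq_ofReal {x : ℝ≥0∞} (hx : x < ∞) (K : ℕ) :
    min (-ENNReal.log x).toENNReal K =
      ENNReal.ofReal (-Real.log (max x.toReal (Real.exp (-K)))) := by
  rcases eq_or_ne x 0 with rfl | h0
  · have : max (0 : ℝ) (Real.exp (-K)) = Real.exp (-K) := max_eq_right (Real.exp_pos _).le
    simp [this]
  have hpos : 0 < x.toReal := ENNReal.toReal_pos h0 hx.ne
  rw [ENNReal.log_pos_real h0 hx.ne, ← EReal.coe_neg,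
    EReal.toENNReal_of_ne_top (EReal.coe_ne_top _), EReal.toReal_coe]
  rcases le_total x.toReal (Real.exp (-K)) with h | h
  · rw [max_eq_right h, Real.log_exp, neg_neg, ENNReal.ofReal_natCast, min_eq_right]
    rw [← ENNReal.ofReal_natCast]
    refine ENNReal.ofReal_le_ofReal ?_
    have := Real.log_le_log hpos h
    rw [Real.log_exp] at this
    linarith
  · rw [max_eq_left h, min_eq_left]
    rw [← ENNReal.ofReal_natCast]
    refine ENNReal.ofReal_le_ofReal ?_
    have := Real.log_le_log (Real.exp_pos _) h
    rw [Real.log_exp] at this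
    linarith

/-- If `E log X < 0` then `X ≤ exp φ` for an integrable `φ` of negative mean. -/
theorem NegativeMeanLog.exists_integrable {S : Type*} [MeasurableSpace S] {μ : Measure S}
    [IsProbabilityMeasure μ] {X : S → ℝ≥0∞} (hX : Measurable X) (hfin : ∀ s, X s < ∞)
    (h : NegativeMeanLog μ X) :
    ∃ φ : S → ℝ, Measurable φ ∧ Integrable φ μ ∧ ∫ s, φ s ∂μ < 0 ∧
      ∀ s, (X s).toReal ≤ Real.exp (φ s) := by
  have hNm : Measurable (fun s => (-ENNReal.log (X s)).toENNReal) := by fun_prop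
  -- Monotone convergence provides a level `K` at which the truncated logarithm still has negative
  -- mean, even if the full mean is `-∞`.
  have hsup : ∫⁻ s, (-ENNReal.log (X s)).toENNReal ∂μ =
      ⨆ K : ℕ, ∫⁻ s, min (-ENNReal.log (X s)).toENNReal K ∂μ := by
    rw [← lintegral_iSup (fun K => hNm.min measurable_const)
      (fun i j hij s => min_le_min le_rfl (by exact_mod_cast hij))]
    refine lintegral_congr fun s => ?_
    rw [← inf_iSup_eq, ENNReal.iSup_natCast, inf_top_eq]
  have h' := h
  rw [NegativeMeanLog, hsup, lt_iSup_iff] at h'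
  obtain ⟨K, hK⟩ := h'
  set φ : S → ℝ := fun s => Real.log (max (X s).toReal (Real.exp (-K))) with hφ
  have hφm : Measurable φ := Real.measurable_log.comp (hX.ennreal_toReal.max measurable_const)
  have hpos : ∀ s, ENNReal.ofReal (φ s) = (ENNReal.log (X s)).toENNReal := by
    intro s
    rw [toENNReal_log_eq_ofReal (hfin s)]
    have hK1 : Real.exp (-(K : ℝ)) ≤ 1 := Real.exp_le_one_iff.2 (by simp)
    rcases le_total (X s).toReal 1 with h1 | h1
    · rw [max_eq_right h1, Real.log_one, ENNReal.ofReal_zero, ENNReal.ofReal_eq_zero]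
      exact Real.log_nonpos (le_max_of_le_right (Real.exp_pos _).le) (max_le h1 hK1)
    · simp only [hφ]; rw [max_eq_left h1, max_eq_left (hK1.trans h1)]
  have hneg : ∀ s, ENNReal.ofReal (-φ s) = min (-ENNReal.log (X s)).toENNReal K := fun s =>
    (min_toENNReal_neg_log_eq_ofReal (hfin s) K).symm
  -- Being strictly below another extended nonnegative number already makes the positive part
  -- finite.
  have hposfin : ∫⁻ s, ENNReal.ofReal (φ s) ∂μ < ∞ := by
    simp only [hpos]; exact lt_of_lt_of_le h le_top
  have hnegfin : ∫⁻ s, ENNReal.ofReal (-φ s) ∂μ < ∞ := by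
    simp only [hneg]
    refine lt_of_le_of_lt (lintegral_mono fun s => min_le_right _ _) ?_
    simp
  have hint : Integrable φ μ := by
    refine ⟨hφm.aestronglyMeasurable, ?_⟩
    rw [hasFiniteIntegral_iff_norm]
    have : ∀ s, ENNReal.ofReal ‖φ s‖ ≤ ENNReal.ofReal (φ s) + ENNReal.ofReal (-φ s) := by
      intro s
      rw [Real.norm_eq_abs]
      rcases le_total 0 (φ s) with h0 | h0
      · rw [abs_of_nonneg h0]; exact le_self_add
      · rw [abs_of_nonpos h0]; exact le_add_self
    refine lt_of_le_of_lt (lintegral_mono this) ?_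
    rw [lintegral_add_left hφm.ennreal_ofReal]
    exact ENNReal.add_lt_top.2 ⟨hposfin, hnegfin⟩
  refine ⟨φ, hφm, hint, ?_, fun s => ?_⟩
  · rw [integral_eq_lintegral_pos_part_sub_lintegral_neg_part hint, sub_neg]
    refine (ENNReal.toReal_lt_toReal hposfin.ne hnegfin.ne).2 ?_
    simpa only [hpos, hneg] using hK
  · rw [hφ, Real.exp_log (lt_max_of_lt_right (Real.exp_pos _))]
    exact le_max_left _ _

/-! ### Forward and backward iterations -/

section Iterations

variable {𝓨 M : Type*} [MeasurableSpace 𝓨] [MetricSpace M] [MeasurableSpace M]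
  (F : LipschitzSystem 𝓨 M)

namespace LipschitzSystem

lemma measurable_forward (n : ℕ) :
    Measurable (fun z : (ℕ → 𝓨) × M => F.forward z.1 n z.2) := by
  induction n with
  | zero => exact measurable_snd
  | succ n ih =>
    exact F.measurable'.comp (((measurable_pi_apply (n + 1)).comp measurable_fst).prodMk ih)

lemma measurable_backward (n : ℕ) :
    Measurable (fun z : (ℕ → 𝓨) × M => F.backward z.1 n z.2) := by
  induction n with
  | zero => exact measurable_snd
  | succ n ih =>
    exact ih.comp (measurable_fst.prodMk
      (F.measurable'.comp (((measurable_pi_apply (n + 1)).comp measurable_fst).prodMk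
        measurable_snd)))

lemma forward_congr {y y' : ℕ → 𝓨} {n : ℕ} (h : ∀ k, k ≤ n → y k = y' k) (u : M) :
    F.forward y n u = F.forward y' n u := by
  induction n with
  | zero => rfl
  | succ n ih => rw [forward, forward, h (n + 1) le_rfl, ih fun k hk => h k (by omega)]

/-- The definition adds maps on the inside; here the outermost map is peeled off instead, as
comparison with forward iterations requires. -/
lemma backward_succ (y : ℕ → 𝓨) (n : ℕ) (u : M) :
    F.backward y (n + 1) u = F (y 1) (F.backward (shift y) n u) := by
  induction n generalizing u with
  | zero => rfl
  | succ n ih => rw [backward, ih]; rfl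

/-- Backward iterations are forward iterations along the reversed sequence. -/
lemma forward_reverse (y : ℕ → 𝓨) (n : ℕ) (u : M) :
    F.forward (fun i => y (n + 1 - i)) n u = F.backward y n u := by
  induction n generalizing y with
  | zero => rfl
  | succ n ih =>
    rw [backward_succ, ← ih, forward]
    have h1 : n + 1 + 1 - (n + 1) = 1 := by omega
    rw [h1]
    congr 1
    refine F.forward_congr (fun k hk => ?_) u
    rw [shift]
    congr 1
    omega

lemma dist_forward_le (y : ℕ → 𝓨) (n : ℕ) (u v : M) :
    dist (F.forward y n u) (F.forward y n v) ≤
      (∏ k ∈ Finset.Icc 1 n, (lipConst (F (y k))).toReal) * dist u v := by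
  induction n with
  | zero => simp [forward]
  | succ n ih =>
    rw [Finset.prod_Icc_succ_top (by omega), mul_comm (∏ k ∈ _, _), mul_assoc]
    exact (dist_le_lipConst_mul F _ _ _).trans (by gcongr)

lemma dist_backward_le (y : ℕ → 𝓨) (n : ℕ) (u v : M) :
    dist (F.backward y n u) (F.backward y n v) ≤
      (∏ k ∈ Finset.Icc 1 n, (lipConst (F (y k))).toReal) * dist u v := by
  induction n generalizing u v with
  | zero => simp [backward]
  | succ n ih =>
    rw [Finset.prod_Icc_succ_top (by omega), mul_assoc]
    refine (ih _ _).trans ?_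
    gcongr
    exact dist_le_lipConst_mul F _ _ _

variable {F}

/-- Exponential decay of the products of Lipschitz constants along a sequence with negative mean
logarithmic Lipschitz constant. -/
lemma exists_prod_lipConst_le {φ : 𝓨 → ℝ} (hφ : ∀ y, (lipConst (F y)).toReal ≤ Real.exp (φ y))
    {y : ℕ → 𝓨} {c : ℝ} (hc : c < 0)
    (hy : Tendsto (fun n : ℕ => (n : ℝ)⁻¹ * ∑ k ∈ Finset.Icc 1 n, φ (y k)) atTop (𝓝 c)) :
    ∀ᶠ n : ℕ in atTop, ∏ k ∈ Finset.Icc 1 n, (lipConst (F (y k))).toReal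
      ≤ Real.exp (c / 2 * n) := by
  -- Half of the negative limit `c` is given away, so that the averages are eventually below `c /
  -- 2`.
  filter_upwards [hy.eventually (ge_mem_nhds (show c < c / 2 by linarith)), eventually_ge_atTop 1]
    with n hn hn1
  have hnpos : (0 : ℝ) < n := by exact_mod_cast hn1
  rw [inv_mul_le_iff₀ hnpos] at hn
  calc ∏ k ∈ Finset.Icc 1 n, (lipConst (F (y k))).toReal
      ≤ ∏ k ∈ Finset.Icc 1 n, Real.exp (φ (y k)) :=
        Finset.prod_le_prod (fun _ _ => ENNReal.toReal_nonneg) fun _ _ => hφ _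
    _ = Real.exp (∑ k ∈ Finset.Icc 1 n, φ (y k)) := (Real.exp_sum _ _).symm
    _ ≤ Real.exp (c / 2 * n) := by
        refine Real.exp_le_exp.2 ?_
        linarith

lemma tendsto_exp_mul_nat {c : ℝ} (hc : c < 0) :
    Tendsto (fun n : ℕ => Real.exp (c * n)) atTop (𝓝 0) :=
  Real.tendsto_exp_atBot.comp (tendsto_natCast_atTop_atTop.const_mul_atTop_of_neg hc)

lemma tendsto_prod_lipConst {φ : 𝓨 → ℝ} (hφ : ∀ y, (lipConst (F y)).toReal ≤ Real.exp (φ y))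
    {y : ℕ → 𝓨} {c : ℝ} (hc : c < 0)
    (hy : Tendsto (fun n : ℕ => (n : ℝ)⁻¹ * ∑ k ∈ Finset.Icc 1 n, φ (y k)) atTop (𝓝 c)) :
    Tendsto (fun n : ℕ => ∏ k ∈ Finset.Icc 1 n, (lipConst (F (y k))).toReal) atTop (𝓝 0) :=
  squeeze_zero' (Eventually.of_forall fun _ => Finset.prod_nonneg fun _ _ => ENNReal.toReal_nonneg)
    (exists_prod_lipConst_le hφ hc hy) (tendsto_exp_mul_nat (by linarith))

/-- Forward iterations started at different points merge. -/
lemma tendsto_dist_forward {φ : 𝓨 → ℝ} (hφ : ∀ y, (lipConst (F y)).toReal ≤ Real.exp (φ y))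
    {y : ℕ → 𝓨} {c : ℝ} (hc : c < 0)
    (hy : Tendsto (fun n : ℕ => (n : ℝ)⁻¹ * ∑ k ∈ Finset.Icc 1 n, φ (y k)) atTop (𝓝 c)) (u v : M) :
    Tendsto (fun n => dist (F.forward y n u) (F.forward y n v)) atTop (𝓝 0) := by
  refine squeeze_zero (fun _ => dist_nonneg) (fun n => F.dist_forward_le y n u v) ?_
  simpa using (tendsto_prod_lipConst hφ hc hy).mul_const (dist u v)

/-- The last term divided by `n + 1` is the average at `n + 1` minus `n / (n + 1)` times the average
at `n`; both tend to `c`. -/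
lemma tendsto_div_of_tendsto_average {a : ℕ → ℝ} {c : ℝ}
    (h : Tendsto (fun n : ℕ => (n : ℝ)⁻¹ * ∑ k ∈ Finset.Icc 1 n, a k) atTop (𝓝 c)) :
    Tendsto (fun n : ℕ => ((n : ℝ) + 1)⁻¹ * a (n + 1)) atTop (𝓝 0) := by
  have h1 := (tendsto_add_atTop_iff_nat 1).2 h
  have h2 : Tendsto (fun n : ℕ => (n : ℝ) / (n + 1) * ((n : ℝ)⁻¹ * ∑ k ∈ Finset.Icc 1 n, a k))
      atTop (𝓝 (1 * c)) := (tendsto_natCast_div_add_atTop 1).mul h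
  have h3 := h1.sub h2
  rw [one_mul, sub_self] at h3
  refine h3.congr' ?_
  filter_upwards [eventually_ge_atTop 1] with n hn
  have hnpos : (0 : ℝ) < n := by exact_mod_cast hn
  rw [Finset.sum_Icc_succ_top (by omega)]
  push_cast
  field_simp
  ring

/-- Almost sure convergence of the backward iterations, for a fixed driving sequence. -/
theorem exists_tendsto_backward [CompleteSpace M] {φ : 𝓨 → ℝ}
    (hφ : ∀ y, (lipConst (F y)).toReal ≤ Real.exp (φ y)) {y : ℕ → 𝓨} {c c' : ℝ} (hc : c < 0)
    (hy : Tendsto (fun n : ℕ => (n : ℝ)⁻¹ * ∑ k ∈ Finset.Icc 1 n, φ (y k)) atTop (𝓝 c))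
    {u₀ : M} (hu : Tendsto (fun n : ℕ => (n : ℝ)⁻¹ *
      ∑ k ∈ Finset.Icc 1 n, Real.posLog (dist (F (y k) u₀) u₀)) atTop (𝓝 c')) :
    ∃ x : M, ∀ u, Tendsto (fun n => F.backward y n u) atTop (𝓝 x) := by
  -- The product of Lipschitz constants is at most `exp (c / 2 * n)` and the displacement of `u₀` at
  -- most `exp (-c / 4 * (n + 1))`; the net rate `c / 4` is still negative, so the distances are
  -- summable.
  have hev : ∀ᶠ n : ℕ in atTop, ‖dist (F.backward y n u₀) (F.backward y (n + 1) u₀)‖ ≤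
      Real.exp (-c / 4) * Real.exp (c / 4) ^ n := by
    have h1 := (tendsto_div_of_tendsto_average hu).eventually
      (ge_mem_nhds (show (0 : ℝ) < -c / 4 by linarith))
    filter_upwards [h1, exists_prod_lipConst_le hφ hc hy] with n hn1 hn2
    have hnpos : (0 : ℝ) < (n : ℝ) + 1 := by positivity
    rw [inv_mul_le_iff₀ hnpos] at hn1
    have hd : dist u₀ (F (y (n + 1)) u₀) ≤ Real.exp (-c / 4 * (n + 1)) := by
      rw [dist_comm]
      calc dist (F (y (n + 1)) u₀) u₀
          ≤ Real.exp (Real.posLog (dist (F (y (n + 1)) u₀) u₀)) := by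
            rcases (dist_nonneg (x := F (y (n + 1)) u₀) (y := u₀)).eq_or_lt with h0 | h0
            · rw [← h0]; exact (Real.exp_pos _).le
            · rw [← Real.log_le_iff_le_exp h0]; exact le_max_right _ _
        _ ≤ Real.exp (-c / 4 * (n + 1)) := Real.exp_le_exp.2 (by linarith)
    rw [Real.norm_of_nonneg dist_nonneg]
    calc dist (F.backward y n u₀) (F.backward y (n + 1) u₀)
        ≤ (∏ k ∈ Finset.Icc 1 n, (lipConst (F (y k))).toReal) * dist u₀ (F (y (n + 1)) u₀) :=
          F.dist_backward_le y n _ _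
      _ ≤ Real.exp (c / 2 * n) * Real.exp (-c / 4 * (n + 1)) := by gcongr
      _ = Real.exp (-c / 4) * Real.exp (c / 4) ^ n := by
          rw [← Real.exp_nat_mul, ← Real.exp_add, ← Real.exp_add]
          congr 1; ring
  have hsum : Summable fun n => dist (F.backward y n u₀) (F.backward y (n + 1) u₀) :=
    Summable.of_norm_bounded_eventually_nat
      ((summable_geometric_of_lt_one (Real.exp_pos _).le
        (Real.exp_lt_one_iff.2 (by linarith))).mul_left _) hev
  obtain ⟨x, hx⟩ := cauchySeq_tendsto_of_complete (cauchySeq_of_summable_dist hsum)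
  refine ⟨x, fun u => ?_⟩
  have hdist : Tendsto (fun n => dist (F.backward y n u₀) (F.backward y n u)) atTop (𝓝 0) := by
    refine squeeze_zero (fun _ => dist_nonneg) (fun n => F.dist_backward_le y n u₀ u) ?_
    simpa using (tendsto_prod_lipConst hφ hc hy).mul_const (dist u₀ u)
  exact hx.congr_dist hdist

end LipschitzSystem

end Iterations

/-! ### Measures on a product with a metric factor -/

section ProductExt

variable {𝓨 M : Type*} [MeasurableSpace 𝓨] [MetricSpace M] [MeasurableSpace M] [BorelSpace M]

/-- Finite measures on `𝓨 × M` are determined by the integrals of products of an indicator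
and a Lipschitz function. -/
theorem prod_measure_ext_of_lipschitz {μ ν : Measure (𝓨 × M)} [IsFiniteMeasure μ]
    [IsFiniteMeasure ν]
    (h : ∀ (A : Set 𝓨) (g : M → ℝ≥0) (K : ℝ≥0), MeasurableSet A → LipschitzWith K g →
      (∀ x, g x ≤ 1) → ∫⁻ z, A.indicator 1 z.1 * (g z.2 : ℝ≥0∞) ∂μ =
        ∫⁻ z, A.indicator 1 z.1 * (g z.2 : ℝ≥0∞) ∂ν) : μ = ν := by
  refine Measure.ext_prod fun {A B} hA hB => ?_
  have hA' : MeasurableSet (Prod.fst ⁻¹' A : Set (𝓨 × M)) := measurable_fst hA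
  have hval : ∀ ρ : Measure (𝓨 × M), ∀ C : Set M, MeasurableSet C →
      (ρ.restrict (Prod.fst ⁻¹' A)).snd C = ρ (A ×ˢ C) := by
    intro ρ C hC
    rw [Measure.snd_apply hC, Measure.restrict_apply (measurable_snd hC), Set.inter_comm]
    rfl
  have hint : ∀ ρ : Measure (𝓨 × M), ∀ g : M → ℝ≥0, Measurable g →
      ∫⁻ u, g u ∂(ρ.restrict (Prod.fst ⁻¹' A)).snd =
        ∫⁻ z, A.indicator 1 z.1 * (g z.2 : ℝ≥0∞) ∂ρ := by
    intro ρ g hg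
    rw [Measure.snd, lintegral_map hg.coe_nnreal_ennreal measurable_snd, ← lintegral_indicator hA']
    refine lintegral_congr fun z => ?_
    by_cases hz : z.1 ∈ A <;> simp [Set.indicator, hz]
  -- Indicators of closed sets are limits of thickened indicators, which are Lipschitz; closed sets
  -- form a π-system generating the Borel sets.
  have hclosed : ∀ C : Set M, IsClosed C → (μ.restrict (Prod.fst ⁻¹' A)).snd C =
      (ν.restrict (Prod.fst ⁻¹' A)).snd C := by
    intro C hC
    have hδ : ∀ n : ℕ, (0 : ℝ) < 1 / ((n : ℝ) + 1) := fun n => by positivity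
    have h1 := tendsto_lintegral_thickenedIndicator_of_isClosed
      (μ.restrict (Prod.fst ⁻¹' A)).snd hC hδ tendsto_one_div_add_atTop_nhds_zero_nat
    have h2 := tendsto_lintegral_thickenedIndicator_of_isClosed
      (ν.restrict (Prod.fst ⁻¹' A)).snd hC hδ tendsto_one_div_add_atTop_nhds_zero_nat
    refine tendsto_nhds_unique h1 (h2.congr fun n => ?_)
    have hL := lipschitzWith_thickenedIndicator (hδ n) C
    rw [hint _ _ hL.continuous.measurable, hint _ _ hL.continuous.measurable]
    exact (h A _ _ hA hL fun x => thickenedIndicator_le_one (hδ n) C x).symm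
  have hsnd : (μ.restrict (Prod.fst ⁻¹' A)).snd = (ν.restrict (Prod.fst ⁻¹' A)).snd :=
    ext_of_generate_finite _ (BorelSpace.measurable_eq.trans borel_eq_generateFrom_isClosed)
      isPiSystem_isClosed hclosed (hclosed _ isClosed_univ)
  rw [← hval μ B hB, ← hval ν B hB, hsnd]

end ProductExt

/-! ### The joint chain -/

section JointChain

variable {𝓨 M Ω : Type*} [MeasurableSpace 𝓨] [MetricSpace M] [MeasurableSpace M]
  [MeasurableSpace Ω] {F : LipschitzSystem 𝓨 M} {P : Kernel 𝓨 𝓨}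
  {Pr : Measure Ω}

lemma LipschitzSystem.measurable_next (F : LipschitzSystem 𝓨 M) (u : M) :
    Measurable (fun z => (z, F z u)) :=
  measurable_id.prodMk (F.measurable'.comp measurable_prodMk_right)

/-- Reversal: forward iterations of the stationary chain have the same laws as backward iterations
of the dual chain. -/
theorem map_forward_eq_map_backward [IsFiniteMeasure Pr] {κ' : Kernel 𝓨 𝓨} {π : Measure 𝓨}
    {Y Yd : ℕ → Ω → 𝓨} (h : IsMarkovSeq P Pr Y) (h0 : Pr.map (Y 0) = π)
    (hd : IsMarkovSeq κ' Pr Yd) (hd0 : Pr.map (Yd 0) = π) (hdual : InDuality P κ' π)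
    {M₀ : Ω → M} (hM₀ : Measurable M₀) (hindep : IndepFun M₀ (fun ω n => Y n ω) Pr)
    (hindep_d : IndepFun M₀ (fun ω n => Yd n ω) Pr) (n : ℕ) :
    Pr.map (fun ω => (Y n ω, F.forward (fun k => Y k ω) n (M₀ ω))) =
      Pr.map (fun ω => (Yd 1 ω, F.backward (fun k => Yd k ω) n (M₀ ω))) := by
  -- The reflection is about `n + 1`, not `n`: it matches `Y 1, …, Y n` with `Yd n, …, Yd 1`, since
  -- the iterations do not use index `0`.
  have hrev : Measurable (fun (x : ℕ → 𝓨) (i : ℕ) => x (n + 1 - i)) :=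
    measurable_pi_lambda _ fun i => measurable_pi_apply _
  have hs : Measurable (fun ω => stopPath (n + 1) (fun k => Y k ω)) :=
    (measurable_stopPath _).comp h.measurable_path
  have hr : Measurable (fun ω (i : ℕ) => Yd (n + 1 - i) ω) := hrev.comp hd.measurable_path
  have e1 := (indepFun_iff_map_prod_eq_prod_map_map hM₀.aemeasurable hs.aemeasurable).1
    (hindep.comp measurable_id (measurable_stopPath (n + 1)))
  have e2 := (indepFun_iff_map_prod_eq_prod_map_map hM₀.aemeasurable hr.aemeasurable).1
    (hindep_d.comp measurable_id hrev)
  rw [h.map_stopPath_eq_reverse h0 hd hd0 hdual (n + 1), ← e2] at e1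
  have hG : Measurable (fun z : M × (ℕ → 𝓨) => (z.2 n, F.forward z.2 n z.1)) :=
    ((measurable_pi_apply n).comp measurable_snd).prodMk
      ((F.measurable_forward n).comp measurable_swap)
  have e3 := congrArg (fun ρ => ρ.map (fun z : M × (ℕ → 𝓨) => (z.2 n, F.forward z.2 n z.1))) e1
  rw [Measure.map_map hG (hM₀.prodMk hs), Measure.map_map hG (hM₀.prodMk hr)] at e3
  have c1 : ((fun z : M × (ℕ → 𝓨) => (z.2 n, F.forward z.2 n z.1)) ∘
      fun ω => (M₀ ω, stopPath (n + 1) (fun k => Y k ω))) =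
      fun ω => (Y n ω, F.forward (fun k => Y k ω) n (M₀ ω)) := by
    ext1 ω
    refine Prod.ext (by simp [stopPath]) ?_
    exact F.forward_congr (fun k hk => by simp [stopPath, min_eq_left (hk.trans n.le_succ)]) _
  have c2 : ((fun z : M × (ℕ → 𝓨) => (z.2 n, F.forward z.2 n z.1)) ∘
      fun ω => (M₀ ω, fun i => Yd (n + 1 - i) ω)) =
      fun ω => (Yd 1 ω, F.backward (fun k => Yd k ω) n (M₀ ω)) := by
    ext1 ω
    refine Prod.ext (by simp) ?_
    exact F.forward_reverse (fun k => Yd k ω) n _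
  rwa [c1, c2] at e3

variable [IsMarkovKernel P]

lemma jointKernel_apply (s : 𝓨 × M) :
    F.jointKernel P s = (P s.1).map (fun z => (z, F z s.2)) := by
  rw [LipschitzSystem.jointKernel, Kernel.map_apply _ F.measurable_graph, Kernel.prod_apply,
    Kernel.comap_apply, Kernel.deterministic_apply, Measure.prod_dirac,
    Measure.map_map F.measurable_graph measurable_prodMk_right]
  rfl

lemma lintegral_jointKernel {h : 𝓨 × M → ℝ≥0∞} (hh : Measurable h) (s : 𝓨 × M) :
    ∫⁻ t, h t ∂(F.jointKernel P s) = ∫⁻ z, h (z, F z s.2) ∂(P s.1) := by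
  rw [jointKernel_apply, lintegral_map hh (F.measurable_next s.2)]

/-- The driving component of a joint chain is Markov. -/
lemma IsMarkovSeq.fst_joint {X : ℕ → Ω → 𝓨 × M} (h : IsMarkovSeq (F.jointKernel P) Pr X) :
    IsMarkovSeq P Pr (fun n ω => (X n ω).1) where
  measurable n := measurable_fst.comp (h.measurable n)
  step n Φ hΦ := by
    have hm : Measurable (fun z : (ℕ → 𝓨 × M) × (𝓨 × M) => (fun k => (z.1 k).1, z.2.1)) :=
      (measurable_pi_lambda _ fun k =>
        measurable_fst.comp ((measurable_pi_apply k).comp measurable_fst)).prodMk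
        (measurable_fst.comp measurable_snd)
    have := h.step n (fun z => Φ (fun k => (z.1 k).1, z.2.1)) (hΦ.comp hm)
    have h2 : ∀ ω, ∫⁻ z, Φ (fun k => (stopPath n (fun k => X k ω) k).1, z.1)
        ∂(F.jointKernel P (X n ω)) =
        ∫⁻ z, Φ (fun k => (stopPath n (fun k => X k ω) k).1, z) ∂(P (X n ω).1) := fun ω =>
      lintegral_jointKernel (h := fun z => Φ (fun k => (stopPath n (fun k => X k ω) k).1, z.1))
        (hΦ.comp (measurable_const.prodMk measurable_fst)) _
    simp only [h2] at this
    exact this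

/-- The law of a driving chain together with its forward iterations evolves by the joint
kernel. -/
lemma IsMarkovSeq.map_forward_succ {Y : ℕ → Ω → 𝓨} (h : IsMarkovSeq P Pr Y) (u : M) (n : ℕ) :
    Pr.map (fun ω => (Y (n + 1) ω, F.forward (fun k => Y k ω) (n + 1) u)) =
      (Pr.map (fun ω => (Y n ω, F.forward (fun k => Y k ω) n u))).bind (F.jointKernel P) := by
  have hm : ∀ n, Measurable (fun ω => (Y n ω, F.forward (fun k => Y k ω) n u)) := fun n =>
    (h.measurable n).prodMk ((F.measurable_forward n).comp
      (h.measurable_path.prodMk measurable_const))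
  refine Measure.ext_of_lintegral _ fun f hf => ?_
  rw [lintegral_map hf (hm _), Measure.lintegral_bind (F.jointKernel P).aemeasurable hf.aemeasurable,
    lintegral_map hf.lintegral_kernel (hm n)]
  have hfw : Measurable (fun z : (ℕ → 𝓨) × 𝓨 => F.forward z.1 n u) :=
    (F.measurable_forward n).comp (measurable_fst.prodMk measurable_const)
  have := h.step n (fun z => f (z.2, F z.2 (F.forward z.1 n u)))
    (hf.comp (measurable_snd.prodMk (F.measurable'.comp (measurable_snd.prodMk hfw))))
  have hst : ∀ ω, F.forward (stopPath n (fun k => Y k ω)) n u = F.forward (fun k => Y k ω) n u :=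
    fun ω => F.forward_congr (fun k hk => by simp [stopPath, min_eq_left hk]) u
  simp only [hst] at this
  simp only [lintegral_jointKernel hf]
  exact this

variable [BorelSpace M] [TopologicalSpace.SeparableSpace M]

/-- The second component of a joint chain is a forward iteration. -/
lemma IsMarkovSeq.ae_snd_eq_forward {X : ℕ → Ω → 𝓨 × M}
    (h : IsMarkovSeq (F.jointKernel P) Pr X) :
    ∀ᵐ ω ∂Pr, ∀ n, (X n ω).2 = F.forward (fun k => (X k ω).1) n (X 0 ω).2 := by
  have : SecondCountableTopology M := UniformSpace.secondCountable_of_separable M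
  have hstep : ∀ n, ∀ᵐ ω ∂Pr, (X (n + 1) ω).2 = F (X (n + 1) ω).1 (X n ω).2 := by
    intro n
    set D : Set ((𝓨 × M) × (𝓨 × M)) := {z | z.2.2 = F z.2.1 z.1.2}
    have hD : MeasurableSet D := measurableSet_eq_fun (measurable_snd.comp measurable_snd)
      (F.measurable'.comp ((measurable_fst.comp measurable_snd).prodMk
        (measurable_snd.comp measurable_fst)))
    have hΦ : Measurable (Dᶜ.indicator (1 : (𝓨 × M) × (𝓨 × M) → ℝ≥0∞)) :=
      measurable_one.indicator hD.compl
    have h1 := h.lintegral_pair n hΦ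
    have h2 : ∀ ω, ∫⁻ z, Dᶜ.indicator (1 : (𝓨 × M) × (𝓨 × M) → ℝ≥0∞) (X n ω, z)
        ∂(F.jointKernel P (X n ω)) = 0 := by
      intro ω
      have hΦω : Measurable fun z => Dᶜ.indicator (1 : (𝓨 × M) × (𝓨 × M) → ℝ≥0∞) (X n ω, z) :=
        hΦ.comp measurable_prodMk_left
      rw [lintegral_jointKernel hΦω]
      simp [D]
    simp only [h2, lintegral_zero] at h1
    have hΦX : Measurable fun ω =>
        Dᶜ.indicator (1 : (𝓨 × M) × (𝓨 × M) → ℝ≥0∞) (X n ω, X (n + 1) ω) :=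
      hΦ.comp ((h.measurable n).prodMk (h.measurable (n + 1)))
    rw [lintegral_eq_zero_iff hΦX] at h1
    filter_upwards [h1] with ω hω
    by_contra hne
    have : (X n ω, X (n + 1) ω) ∈ Dᶜ := hne
    simp [Set.indicator_of_mem this] at hω
  filter_upwards [ae_all_iff.2 hstep] with ω hω n
  induction n with
  | zero => rfl
  | succ n ih => rw [hω n, ih]; rfl

end JointChain

/-! ### Stationary laws of the joint chain -/

lemma test_function_le_one {𝓨 M : Type*} {A : Set 𝓨} {g : M → ℝ≥0} (hg : ∀ x, g x ≤ 1)
    (z : 𝓨 × M) : A.indicator (1 : 𝓨 → ℝ≥0∞) z.1 * (g z.2 : ℝ≥0∞) ≤ 1 := by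
  refine mul_le_one' ?_ (by exact_mod_cast hg _)
  by_cases hz : z.1 ∈ A <;> simp [hz]

lemma continuous_test_function {𝓨 M : Type*} [TopologicalSpace M] {A : Set 𝓨} {g : M → ℝ≥0}
    (hg : Continuous g) (y : 𝓨) :
    Continuous fun u => A.indicator (1 : 𝓨 → ℝ≥0∞) y * (g u : ℝ≥0∞) := by
  have hg' : Continuous fun u => (g u : ℝ≥0∞) := ENNReal.continuous_coe.comp hg
  by_cases hy : y ∈ A
  · simpa [hy] using hg'
  · simpa [hy] using continuous_const

section JointStationary

variable {𝓨 M Ω : Type*} [MeasurableSpace 𝓨] [MetricSpace M] [MeasurableSpace M]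
  [MeasurableSpace Ω] {F : LipschitzSystem 𝓨 M} {P : Kernel 𝓨 𝓨} [IsMarkovKernel P]
  {Pr : Measure Ω} [IsProbabilityMeasure Pr] {V : Ω → 𝓨} {Z : ℕ → Ω → M} {Zlim : Ω → M}

/-- Dominated convergence suffices with continuity in `u` alone, because the driving coordinate `V`
does not vary with `n`. -/
lemma tendsto_lintegral_of_continuous_snd (hV : Measurable V) (hZ : ∀ n, Measurable (Z n))
    (hlim : ∀ᵐ ω ∂Pr, Tendsto (fun n => Z n ω) atTop (𝓝 (Zlim ω))) {h : 𝓨 × M → ℝ≥0∞}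
    (hm : Measurable h) (h1 : ∀ s, h s ≤ 1) (hc : ∀ y, Continuous fun u => h (y, u)) :
    Tendsto (fun n => ∫⁻ ω, h (V ω, Z n ω) ∂Pr) atTop (𝓝 (∫⁻ ω, h (V ω, Zlim ω) ∂Pr)) := by
  refine tendsto_lintegral_of_dominated_convergence (fun _ => 1)
    (fun n => hm.comp (hV.prodMk (hZ n))) (fun n => Eventually.of_forall fun ω => h1 _) (by simp) ?_
  filter_upwards [hlim] with ω hω
  exact ((hc (V ω)).tendsto _).comp hω

/-- A Feller property in the metric coordinate only: the joint kernel preserves the class of test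
functions continuous in `u`. -/
lemma continuous_lintegral_next {h : 𝓨 × M → ℝ≥0∞} (hm : Measurable h) (h1 : ∀ s, h s ≤ 1)
    (hc : ∀ y, Continuous fun u => h (y, u)) (y : 𝓨) :
    Continuous fun u => ∫⁻ z, h (z, F z u) ∂(P y) := by
  refine continuous_iff_continuousAt.2 fun u => ?_
  refine tendsto_lintegral_filter_of_dominated_convergence (fun _ => 1)
    (Eventually.of_forall fun v => hm.comp (F.measurable_next v))
    (Eventually.of_forall fun v => Eventually.of_forall fun z => h1 _) (by simp) ?_
  exact Eventually.of_forall fun z => (((hc z).comp (F.continuous z)).tendsto u)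

variable [BorelSpace M]

lemma measurable_test_function {A : Set 𝓨} (hA : MeasurableSet A) {g : M → ℝ≥0}
    (hg : Continuous g) :
    Measurable fun z : 𝓨 × M => A.indicator (1 : 𝓨 → ℝ≥0∞) z.1 * (g z.2 : ℝ≥0∞) :=
  ((measurable_one.indicator hA).comp measurable_fst).mul
    (hg.measurable.comp measurable_snd).coe_nnreal_ennreal

/-- Limits of the laws of the joint chain are stationary. -/
theorem invariant_of_ae_tendsto (hV : Measurable V) (hZ : ∀ n, Measurable (Z n))
    (hZlim : Measurable Zlim)
    (hlim : ∀ᵐ ω ∂Pr, Tendsto (fun n => Z n ω) atTop (𝓝 (Zlim ω)))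
    (hstep : ∀ n, Pr.map (fun ω => (V ω, Z (n + 1) ω)) =
      (Pr.map (fun ω => (V ω, Z n ω))).bind (F.jointKernel P)) :
    Kernel.Invariant (F.jointKernel P) (Pr.map (fun ω => (V ω, Zlim ω))) := by
  have hpair : Measurable fun ω => (V ω, Zlim ω) := hV.prodMk hZlim
  have hprob : IsProbabilityMeasure (Pr.map (fun ω => (V ω, Zlim ω))) :=
    Measure.isProbabilityMeasure_map hpair.aemeasurable
  refine prod_measure_ext_of_lipschitz fun A g K hA hg hg1 => ?_
  have hm := measurable_test_function hA hg.continuous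
  have h1 := test_function_le_one (A := A) hg1
  have hc := continuous_test_function (A := A) hg.continuous
  have hκm := hm.lintegral_kernel (κ := F.jointKernel P)
  rw [Measure.lintegral_bind (F.jointKernel P).aemeasurable hm.aemeasurable,
    lintegral_map hκm hpair, lintegral_map hm hpair]
  -- The integrals of the test function at time `n + 1` are also the integrals of its image under
  -- the kernel at time `n`, so the two limits coincide.
  have t1 := tendsto_lintegral_of_continuous_snd hV hZ hlim hκm
    (fun s => (lintegral_mono h1).trans (by simp))
    (fun y => by
      simp only [lintegral_jointKernel hm]
      exact continuous_lintegral_next hm h1 hc y)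
  have t2 := (tendsto_add_atTop_iff_nat 1).2
    (tendsto_lintegral_of_continuous_snd hV hZ hlim hm h1 hc)
  refine tendsto_nhds_unique t1 (t2.congr fun n => ?_)
  rw [← lintegral_map hm (hV.prodMk (hZ (n + 1))), hstep,
    Measure.lintegral_bind (F.jointKernel P).aemeasurable hm.aemeasurable,
    lintegral_map hκm (hV.prodMk (hZ n))]

end JointStationary

/-! ### Uniqueness of the stationary law of the joint chain -/

/-- The truncation at `1` keeps the error bounded, so it vanishes in mean as soon as distances
vanish almost surely, without any moment on them. -/
lemma coe_le_add_min_edist {M : Type*} [MetricSpace M] {g : M → ℝ≥0} {K : ℝ≥0}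
    (hg : LipschitzWith K g) (hg1 : ∀ x, g x ≤ 1) (a b : M) : (g a : ℝ≥0∞) ≤ g b + min (K * edist a b) 1 := by
  rw [← min_add_add_left]
  refine le_min ?_ ((by exact_mod_cast hg1 a : (g a : ℝ≥0∞) ≤ 1).trans le_add_self)
  refine le_trans ?_ (add_le_add le_rfl (hg a b))
  rw [edist_nndist]
  exact_mod_cast NNReal.le_add_nndist (g a) (g b)

section Uniqueness

variable {𝓨 M Ω : Type*} [MeasurableSpace 𝓨] [MetricSpace M] [MeasurableSpace M]
  [MeasurableSpace Ω] {F : LipschitzSystem 𝓨 M} {P : Kernel 𝓨 𝓨} [IsMarkovKernel P]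
  {π : Measure 𝓨} [IsProbabilityMeasure π] {φ : 𝓨 → ℝ}

/-- Along a stationary driving chain, forward iterations merge almost surely. -/
lemma IsMarkovSeq.ae_tendsto_dist_forward {Pr : Measure Ω} [IsProbabilityMeasure Pr]
    {Y : ℕ → Ω → 𝓨} (h : IsMarkovSeq P Pr Y) (h0 : Pr.map (Y 0) = π)
    (hinv : Kernel.Invariant P π) (herg : IsErgodicKernel P π) (hφm : Measurable φ)
    (hφi : Integrable φ π) (hφ0 : ∫ y, φ y ∂π < 0)
    (hφ : ∀ y, (lipConst (F y)).toReal ≤ Real.exp (φ y)) :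
    ∀ᵐ ω ∂Pr, ∀ u v, Tendsto (fun n => dist (F.forward (fun k => Y k ω) n u)
      (F.forward (fun k => Y k ω) n v)) atTop (𝓝 0) := by
  filter_upwards [h.ae_tendsto_average_Icc h0 hinv herg hφm hφi] with ω hω u v
  exact LipschitzSystem.tendsto_dist_forward (y := fun k => Y k ω) hφ hφ0 hω u v

variable [BorelSpace M] [TopologicalSpace.SeparableSpace M]

lemma tendsto_lintegral_min_edist {Pr : Measure Ω} [IsProbabilityMeasure Pr] {Z Z' : ℕ → Ω → M}
    (hZ : ∀ n, Measurable (Z n)) (hZ' : ∀ n, Measurable (Z' n))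
    (h : ∀ᵐ ω ∂Pr, Tendsto (fun n => dist (Z n ω) (Z' n ω)) atTop (𝓝 0)) (K : ℝ≥0) :
    Tendsto (fun n => ∫⁻ ω, min (K * edist (Z n ω) (Z' n ω)) 1 ∂Pr) atTop (𝓝 0) := by
  have : SecondCountableTopology M := UniformSpace.secondCountable_of_separable M
  have key := tendsto_lintegral_of_dominated_convergence (μ := Pr)
    (F := fun n ω => min (K * edist (Z n ω) (Z' n ω)) 1) (f := fun _ => 0) (fun _ => 1)
    (fun n => (((hZ n).edist (hZ' n)).const_mul _).min measurable_const)
    (fun n => Eventually.of_forall fun ω => min_le_right _ _) (by simp) (by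
      filter_upwards [h] with ω hω
      have h1 : Tendsto (fun n => edist (Z n ω) (Z' n ω)) atTop (𝓝 0) := by
        simpa [edist_dist] using ENNReal.tendsto_ofReal hω
      have h2 := (ENNReal.Tendsto.const_mul h1 (Or.inr (ENNReal.coe_ne_top (r := K)))).min
        (tendsto_const_nhds (x := (1 : ℝ≥0∞)))
      simpa using h2)
  simpa using key

/-- Every stationary law of the joint chain is the limit of the laws of the joint chain started at
a fixed point of `M` with stationary driving chain. -/
theorem eq_of_invariant_joint {Pr : Measure Ω} [IsProbabilityMeasure Pr] {Y : ℕ → Ω → 𝓨}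
    (h : IsMarkovSeq P Pr Y) (h0 : Pr.map (Y 0) = π)
    (hinv : Kernel.Invariant P π) (herg : IsErgodicKernel P π) (hφm : Measurable φ)
    (hφi : Integrable φ π) (hφ0 : ∫ y, φ y ∂π < 0)
    (hφ : ∀ y, (lipConst (F y)).toReal ≤ Real.exp (φ y))
    (huniq : ∀ ν' : Measure 𝓨, IsProbabilityMeasure ν' → Kernel.Invariant P ν' → ν' = π)
    {u₀ : M} {Γ : Measure (𝓨 × M)} [IsProbabilityMeasure Γ]
    (hconv : ∀ f : 𝓨 × M → ℝ≥0∞, Measurable f → (∀ s, f s ≤ 1) →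
      (∀ y, Continuous fun u => f (y, u)) →
      Tendsto (fun n => ∫⁻ ω, f (Y n ω, F.forward (fun k => Y k ω) n u₀) ∂Pr) atTop
        (𝓝 (∫⁻ s, f s ∂Γ)))
    {ν : Measure (𝓨 × M)} [IsProbabilityMeasure ν] (hν : Kernel.Invariant (F.jointKernel P) ν) :
    ν = Γ := by
  have hX := (isMarkovChain_chainLaw (κ := F.jointKernel P) ν).isMarkovSeq
  have hX0 := (isMarkovChain_chainLaw (κ := F.jointKernel P) ν).initial.map_eq
  set Q := chainLaw (F.jointKernel P) ν
  have hY' := hX.fst_joint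
  have hfst : ∀ n, Q.map (fun x => (x n).1) = ν.map Prod.fst := fun n => by
    rw [← hX.map_eq_of_invariant hX0 hν n, Measure.map_map measurable_fst (measurable_pi_apply n)]
    rfl
  -- The driving marginal of a stationary joint law is stationary for `P`, hence equal to `π`; the
  -- driving path then has the law of `Y`.
  have hY'0 : Q.map (fun x => (x 0).1) = π := by
    refine huniq _ (Measure.isProbabilityMeasure_map (hY'.measurable 0).aemeasurable) ?_
    rw [Kernel.Invariant, ← hY'.map_succ 0, hfst, hfst]
  have hpath := hY'.map_path_eq h (hY'0.trans h0.symm)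
  have hfm : ∀ (n : ℕ) (w : (ℕ → 𝓨 × M) → M), Measurable w →
      Measurable fun x : ℕ → 𝓨 × M => F.forward (fun k => (x k).1) n (w x) := fun n w hw =>
    (F.measurable_forward n).comp (hY'.measurable_path.prodMk hw)
  have hm0 : Measurable fun x : ℕ → 𝓨 × M => (x 0).2 :=
    measurable_snd.comp (measurable_pi_apply 0)
  have hmerge := hY'.ae_tendsto_dist_forward hY'0 hinv herg hφm hφi hφ0 hφ
  refine prod_measure_ext_of_lipschitz fun A g K hA hg hg1 => ?_
  set f : 𝓨 × M → ℝ≥0∞ := fun z => A.indicator 1 z.1 * (g z.2 : ℝ≥0∞) with hf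
  have hfmeas : Measurable f := measurable_test_function hA hg.continuous
  set a : ℕ → ℝ≥0∞ := fun n => ∫⁻ x, f ((x n).1, F.forward (fun k => (x k).1) n u₀) ∂Q
  -- `e n` bounds the cost of replacing the random start by `u₀`. It tends to zero by merging, while
  -- `a n` tends to the integral under `Γ` and the integral under `ν` is the same at all times.
  set e : ℕ → ℝ≥0∞ := fun n => ∫⁻ x, min (K * edist (F.forward (fun k => (x k).1) n (x 0).2)
    (F.forward (fun k => (x k).1) n u₀)) 1 ∂Q
  have ha : Tendsto a atTop (𝓝 (∫⁻ s, f s ∂Γ)) := by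
    refine (hconv f hfmeas (test_function_le_one hg1)
      (continuous_test_function hg.continuous)).congr fun n => ?_
    have hm : Measurable fun y : ℕ → 𝓨 => f (y n, F.forward y n u₀) :=
      hfmeas.comp ((measurable_pi_apply n).prodMk
        ((F.measurable_forward n).comp (measurable_id.prodMk measurable_const)))
    have e1 := lintegral_map (μ := Pr) hm h.measurable_path
    have e2 := lintegral_map (μ := Q) hm hY'.measurable_path
    rw [hpath, e1] at e2
    exact e2
  have he : Tendsto e atTop (𝓝 0) :=
    tendsto_lintegral_min_edist (fun n => hfm n _ hm0) (fun n => hfm n _ measurable_const)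
      (hmerge.mono fun x hx => hx _ _) K
  have hνn : ∀ n, ∫⁻ s, f s ∂ν =
      ∫⁻ x, f ((x n).1, F.forward (fun k => (x k).1) n (x 0).2) ∂Q := fun n => by
    rw [← hX.map_eq_of_invariant hX0 hν n, lintegral_map hfmeas (measurable_pi_apply n)]
    refine lintegral_congr_ae ?_
    filter_upwards [hX.ae_snd_eq_forward] with x hx
    rw [← hx n]
  have hle : ∀ (y : 𝓨) (u v : M), f (y, u) ≤ f (y, v) + min (K * edist u v) 1 := by
    intro y u v
    by_cases hy : y ∈ A
    · simpa [hf, hy] using coe_le_add_min_edist hg hg1 u v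
    · simp [hf, hy]
  have hmin : ∀ n, Measurable fun x : ℕ → 𝓨 × M => f ((x n).1, F.forward (fun k => (x k).1) n u₀) :=
    fun n => hfmeas.comp ((hY'.measurable n).prodMk (hfm n _ measurable_const))
  have hmin' : ∀ n, Measurable fun x : ℕ → 𝓨 × M =>
      f ((x n).1, F.forward (fun k => (x k).1) n (x 0).2) :=
    fun n => hfmeas.comp ((hY'.measurable n).prodMk (hfm n _ hm0))
  refine le_antisymm ?_ ?_
  · have hlim : Tendsto (fun n => a n + e n) atTop (𝓝 (∫⁻ s, f s ∂Γ)) := by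
      simpa using ha.add he
    refine ge_of_tendsto' hlim fun n => ?_
    rw [hνn n, ← lintegral_add_left (hmin n)]
    exact lintegral_mono fun x => hle _ _ _
  · have hlim : Tendsto (fun n => ∫⁻ s, f s ∂ν + e n) atTop (𝓝 (∫⁻ s, f s ∂ν)) := by
      simpa using tendsto_const_nhds.add he
    refine le_of_tendsto_of_tendsto' ha hlim fun n => ?_
    rw [hνn n, ← lintegral_add_left (hmin' n)]
    refine lintegral_mono fun x => ?_
    have := hle (x n).1 (F.forward (fun k => (x k).1) n u₀) (F.forward (fun k => (x k).1) n (x 0).2)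
    rwa [edist_comm] at this

end Uniqueness

/-! ### Ergodic averages of merging sequences -/

section MergingAverages

variable {M : Type*} [MetricSpace M]

/-- The points at which `g` varies by at most `ε` within distance `δ`. -/
def smallOscillation (g : M → ℝ) (δ ε : ℝ) : Set M :=
  {a | ∀ b, dist a b < δ → |g a - g b| ≤ ε}

lemma isClosed_smallOscillation {g : M → ℝ} (hg : Continuous g) (δ ε : ℝ) :
    IsClosed (smallOscillation g δ ε) := by
  have : smallOscillation g δ ε = ⋂ b, ({a | δ ≤ dist a b} ∪ {a | |g a - g b| ≤ ε}) := by
    ext a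
    simp only [smallOscillation, Set.mem_ofPred_eq, Set.mem_iInter, Set.mem_union]
    exact forall_congr' fun b => by rw [imp_iff_not_or, not_lt]
  rw [this]
  exact isClosed_iInter fun b =>
    (isClosed_le continuous_const (continuous_id.dist continuous_const)).union
      (isClosed_le (hg.sub continuous_const).abs continuous_const)

/-- A continuous function has small oscillation outside sets of small measure. -/
lemma exists_measure_compl_smallOscillation_le [MeasurableSpace M] [BorelSpace M] {μ : Measure M}
    [IsFiniteMeasure μ] {g : M → ℝ} (hg : Continuous g) {ε : ℝ} (hε : 0 < ε) :
    ∃ δ > 0, μ.real (smallOscillation g δ ε)ᶜ ≤ ε := by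
  set B : ℕ → Set M := fun i => (smallOscillation g (1 / ((i : ℝ) + 1)) ε)ᶜ
  have hanti : Antitone B := by
    intro i j hij
    refine Set.compl_subset_compl.2 fun a ha b hb => ha b (hb.trans_le ?_)
    exact one_div_le_one_div_of_le (by positivity) (by gcongr)
  -- Continuity at a point places it in the small-oscillation set for some radius, so the
  -- exceptional sets decrease to the empty set.
  have hempty : ⋂ i, B i = ∅ := by
    refine Set.eq_empty_iff_forall_notMem.2 fun a ha => ?_
    obtain ⟨δ, hδ, hδ'⟩ := Metric.continuousAt_iff.1 (hg.continuousAt (x := a)) ε hε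
    obtain ⟨i, hi⟩ := exists_nat_one_div_lt hδ
    refine Set.mem_iInter.1 ha i fun b hb => ?_
    rw [abs_sub_comm]
    exact (hδ' (by rw [dist_comm]; exact hb.trans hi)).le
  have ht := tendsto_measure_iInter_atTop (μ := μ) (s := B)
    (fun i => (isClosed_smallOscillation hg _ _).measurableSet.compl.nullMeasurableSet) hanti
    ⟨0, measure_ne_top _ _⟩
  rw [hempty, measure_empty] at ht
  obtain ⟨i, hi⟩ := (ht.eventually (ge_mem_nhds (ENNReal.ofReal_pos.2 hε))).exists
  exact ⟨1 / ((i : ℝ) + 1), by positivity, ENNReal.toReal_le_of_le_ofReal hε.le hi⟩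

lemma sum_Icc_one_eq_sum_range (a : ℕ → ℝ) (n : ℕ) :
    ∑ k ∈ Finset.Icc 1 n, a k = ∑ k ∈ Finset.range n, a (k + 1) := by
  rw [Finset.range_eq_Ico, Finset.sum_Ico_add' a, zero_add, Finset.Ico_add_one_right_eq_Icc]

/-- Merging sequences have the same ergodic averages. -/
theorem tendsto_average_of_tendsto_dist {x x' : ℕ → M}
    (hd : Tendsto (fun n => dist (x n) (x' n)) atTop (𝓝 0)) {g : M → ℝ} {C c : ℝ}
    (hC : ∀ a, |g a| ≤ C)
    (hx : Tendsto (fun n : ℕ => (n : ℝ)⁻¹ * ∑ k ∈ Finset.Icc 1 n, g (x k)) atTop (𝓝 c))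
    (hosc : ∀ j : ℕ, ∃ δ > 0, ∃ r ≤ 1 / ((j : ℝ) + 1), Tendsto (fun n : ℕ => (n : ℝ)⁻¹ *
      ∑ k ∈ Finset.Icc 1 n, (smallOscillation g δ (1 / ((j : ℝ) + 1)))ᶜ.indicator 1 (x k)) atTop
        (𝓝 r)) :
    Tendsto (fun n : ℕ => (n : ℝ)⁻¹ * ∑ k ∈ Finset.Icc 1 n, g (x' k)) atTop (𝓝 c) := by
  have hC0 : 0 ≤ C := (abs_nonneg _).trans (hC (x 0))
  suffices hdiff : Tendsto (fun n : ℕ => (n : ℝ)⁻¹ * ∑ k ∈ Finset.Icc 1 n, |g (x' k) - g (x k)|)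
      atTop (𝓝 0) by
    have h1 : Tendsto (fun n : ℕ => (n : ℝ)⁻¹ * ∑ k ∈ Finset.Icc 1 n, (g (x' k) - g (x k)))
        atTop (𝓝 0) := by
      refine squeeze_zero_norm (fun n => ?_) hdiff
      rw [norm_mul, Real.norm_of_nonneg (by positivity)]
      gcongr
      exact Finset.abs_sum_le_sum_abs _ _
    have h2 := hx.add h1
    simp only [← mul_add, ← Finset.sum_add_distrib, add_sub_cancel, add_zero] at h2
    exact h2
  rw [Metric.tendsto_nhds]
  intro η hη
  have hlim : Tendsto (fun j : ℕ => (1 + 2 * C) * (1 / ((j : ℝ) + 1))) atTop (𝓝 0) := by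
    simpa using (tendsto_one_div_add_atTop_nhds_zero_nat (𝕜 := ℝ)).const_mul (1 + 2 * C)
  obtain ⟨j, hj⟩ := (hlim.eventually (gt_mem_nhds hη)).exists
  obtain ⟨δ, hδ, r, hr, hfreq⟩ := hosc j
  set ε : ℝ := 1 / ((j : ℝ) + 1) with hε
  have hε0 : 0 < ε := by positivity
  set I : M → ℝ := (smallOscillation g δ ε)ᶜ.indicator 1
  set far : ℕ → ℝ := fun k => if dist (x k) (x' k) < δ then 0 else 1
  have hfar : Tendsto (fun n : ℕ => (n : ℝ)⁻¹ * ∑ k ∈ Finset.Icc 1 n, far k) atTop (𝓝 0) := by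
    simp only [sum_Icc_one_eq_sum_range]
    refine Filter.Tendsto.cesaro ((tendsto_add_atTop_iff_nat 1).2 ?_)
    refine tendsto_const_nhds.congr' ?_
    filter_upwards [hd.eventually (gt_mem_nhds hδ)] with k hk
    simp [far, hk]
  -- As `g` need not be uniformly continuous, closeness of `x k` and `x' k` helps only where `g`
  -- oscillates little. The other times, at bad points or with distant pairs, cost at most `2 * C`
  -- each: the first have small frequency, the second frequency zero.
  have hterm : ∀ k, |g (x' k) - g (x k)| ≤ ε + 2 * C * I (x k) + 2 * C * far k := by
    intro k
    have hI : 0 ≤ I (x k) := Set.indicator_nonneg (fun _ _ => zero_le_one) _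
    have hf : 0 ≤ far k := by simp only [far]; split_ifs <;> norm_num
    have hbig : |g (x' k) - g (x k)| ≤ 2 * C :=
      (abs_sub _ _).trans (by linarith [hC (x' k), hC (x k)])
    have h2I : 0 ≤ 2 * C * I (x k) := by positivity
    have h2f : 0 ≤ 2 * C * far k := by positivity
    by_cases hk : dist (x k) (x' k) < δ
    · by_cases hG : x k ∈ smallOscillation g δ ε
      · have := hG (x' k) hk
        rw [abs_sub_comm]
        linarith
      · have : I (x k) = 1 := Set.indicator_of_mem (by exact hG) _
        rw [this] at h2I ⊢
        linarith
    · have : far k = 1 := if_neg hk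
      rw [this] at h2f ⊢
      linarith
  have hsum : Tendsto (fun n : ℕ => ε + 2 * C * ((n : ℝ)⁻¹ * ∑ k ∈ Finset.Icc 1 n, I (x k)) +
      2 * C * ((n : ℝ)⁻¹ * ∑ k ∈ Finset.Icc 1 n, far k)) atTop
      (𝓝 (ε + 2 * C * r + 2 * C * 0)) :=
    (tendsto_const_nhds.add (hfreq.const_mul _)).add (hfar.const_mul _)
  have hlt : ε + 2 * C * r + 2 * C * 0 < η := by
    have : 2 * C * r ≤ 2 * C * ε := by gcongr
    linarith
  filter_upwards [hsum.eventually (gt_mem_nhds hlt), eventually_ge_atTop 1] with n hn hn1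
  have hnpos : (0 : ℝ) < n := by exact_mod_cast hn1
  rw [Real.dist_eq, sub_zero, abs_of_nonneg
    (mul_nonneg (by positivity) (Finset.sum_nonneg fun _ _ => abs_nonneg _))]
  refine lt_of_le_of_lt ?_ hn
  calc (n : ℝ)⁻¹ * ∑ k ∈ Finset.Icc 1 n, |g (x' k) - g (x k)|
      ≤ (n : ℝ)⁻¹ * ∑ k ∈ Finset.Icc 1 n, (ε + 2 * C * I (x k) + 2 * C * far k) := by
        gcongr with k _
        exact hterm k
    _ = ε + 2 * C * ((n : ℝ)⁻¹ * ∑ k ∈ Finset.Icc 1 n, I (x k)) +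
        2 * C * ((n : ℝ)⁻¹ * ∑ k ∈ Finset.Icc 1 n, far k) := by
        rw [Finset.sum_add_distrib, Finset.sum_add_distrib, ← Finset.mul_sum, ← Finset.mul_sum]
        simp only [Finset.sum_const, Nat.card_Icc, add_tsub_cancel_right, nsmul_eq_mul]
        field_simp

end MergingAverages

/-! ### Strong law for the dual chain and ergodic averages of the joint chain -/

section Conclusion

/-- The strong law of the dual chain for the sums over `1, …, n`. -/
theorem IsMarkovSeq.ae_tendsto_average_dual_Icc {S Ω : Type*} [MeasurableSpace S]
    [MeasurableSpace Ω] {Pr : Measure Ω} [IsProbabilityMeasure Pr] {κ κ' : Kernel S S}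
    {X Xd : ℕ → Ω → S} {μ : Measure S} [IsMarkovKernel κ] [IsProbabilityMeasure μ]
    [IsSFiniteKernel κ'] (h : IsMarkovSeq κ Pr X) (h0 : Pr.map (X 0) = μ)
    (hd : IsMarkovSeq κ' Pr Xd) (hd0 : Pr.map (Xd 0) = μ) (hdual : InDuality κ κ' μ)
    (hinv : Kernel.Invariant κ μ) (herg : IsErgodicKernel κ μ)
    {f : S → ℝ} (hf : Measurable f) (hint : Integrable f μ) :
    ∀ᵐ ω ∂Pr, Tendsto (fun n : ℕ => (n : ℝ)⁻¹ * ∑ k ∈ Finset.Icc 1 n, f (Xd k ω)) atTop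
      (𝓝 (∫ s, f s ∂μ)) := by
  filter_upwards [h.ae_tendsto_average_dual h0 hd.shift
    (hd.map_eq_of_invariant hd0 hdual.invariant 1) hdual hinv herg hf hint] with ω hω
  simpa only [sum_Icc_one_eq_sum_range] using hω

variable {𝓨 M : Type*} [MeasurableSpace 𝓨] [MetricSpace M] [MeasurableSpace M]
  [BorelSpace M] [TopologicalSpace.SeparableSpace M] {F : LipschitzSystem 𝓨 M}
  {P : Kernel 𝓨 𝓨} [IsMarkovKernel P] {π : Measure 𝓨} [IsProbabilityMeasure π] {φ : 𝓨 → ℝ}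

/-- The ergodic theorem for the joint chain and for forward iterations from a fixed point, under
the stationary law of the joint chain. -/
theorem ae_tendsto_average_chainLaw (hinv : Kernel.Invariant P π) (herg : IsErgodicKernel P π)
    (hφm : Measurable φ) (hφi : Integrable φ π) (hφ0 : ∫ y, φ y ∂π < 0)
    (hφ : ∀ y, (lipConst (F y)).toReal ≤ Real.exp (φ y))
    {Γ : Measure (𝓨 × M)} [IsProbabilityMeasure Γ] (hΓ : Kernel.Invariant (F.jointKernel P) Γ)
    (hΓ_uniq : ∀ ν : Measure (𝓨 × M), IsProbabilityMeasure ν →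
      Kernel.Invariant (F.jointKernel P) ν → ν = Γ) (hfst : Γ.fst = π) (u : M) (g : M →ᵇ ℝ) :
    ∀ᵐ x ∂(chainLaw (F.jointKernel P) Γ),
      Tendsto (fun n : ℕ => (n : ℝ)⁻¹ * ∑ k ∈ Finset.Icc 1 n, g (x k).2) atTop
        (𝓝 (∫ s, g s.2 ∂Γ)) ∧
      Tendsto (fun n : ℕ => (n : ℝ)⁻¹ *
        ∑ k ∈ Finset.Icc 1 n, g (F.forward (fun i => (x i).1) k u)) atTop
        (𝓝 (∫ s, g s.2 ∂Γ)) := by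
  have hX := (isMarkovChain_chainLaw (κ := F.jointKernel P) Γ).isMarkovSeq
  have hX0 := (isMarkovChain_chainLaw (κ := F.jointKernel P) Γ).initial.map_eq
  have hergΓ := isErgodicKernel_of_unique hΓ hΓ_uniq
  have hY0 : (chainLaw (F.jointKernel P) Γ).map (fun x => (x 0).1) = π := by
    have e := congrArg (Measure.map Prod.fst) hX0
    rw [Measure.map_map measurable_fst (measurable_pi_apply 0)] at e
    exact e.trans hfst
  -- The bound `‖g‖ + 1` accommodates both `g` and the indicators of the bad sets.
  have hlln : ∀ f : M → ℝ, Measurable f → (∀ a, |f a| ≤ ‖g‖ + 1) →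
      ∀ᵐ x ∂(chainLaw (F.jointKernel P) Γ),
        Tendsto (fun n : ℕ => (n : ℝ)⁻¹ * ∑ k ∈ Finset.Icc 1 n, f (x k).2) atTop
          (𝓝 (∫ s, f s.2 ∂Γ)) := fun f hf hb =>
    hX.ae_tendsto_average_Icc (f := fun s => f s.2) hX0 hΓ hergΓ (hf.comp measurable_snd)
      (integrable_of_measurable_bounded (hf.comp measurable_snd) fun s => hb s.2)
  have hosc : ∀ j : ℕ, ∃ δ > 0,
      Γ.snd.real (smallOscillation g δ (1 / ((j : ℝ) + 1)))ᶜ ≤ 1 / ((j : ℝ) + 1) := fun j =>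
    exists_measure_compl_smallOscillation_le g.continuous (by positivity)
  -- One radius per `j` leaves countably many frequencies to control, hence a single null set.
  choose δ hδ hδ' using hosc
  have hBm : ∀ j : ℕ, MeasurableSet (smallOscillation g (δ j) (1 / ((j : ℝ) + 1)))ᶜ := fun j =>
    (isClosed_smallOscillation g.continuous _ _).measurableSet.compl
  have hfreq : ∀ j : ℕ, ∀ᵐ x ∂(chainLaw (F.jointKernel P) Γ),
      Tendsto (fun n : ℕ => (n : ℝ)⁻¹ * ∑ k ∈ Finset.Icc 1 n,
        (smallOscillation g (δ j) (1 / ((j : ℝ) + 1)))ᶜ.indicator (1 : M → ℝ) (x k).2) atTop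
        (𝓝 (Γ.snd.real (smallOscillation g (δ j) (1 / ((j : ℝ) + 1)))ᶜ)) := fun j => by
    have hval : ∫ s, (smallOscillation g (δ j) (1 / ((j : ℝ) + 1)))ᶜ.indicator (1 : M → ℝ) s.2 ∂Γ =
        Γ.snd.real (smallOscillation g (δ j) (1 / ((j : ℝ) + 1)))ᶜ := by
      rw [← integral_indicator_one (hBm j), Measure.snd, integral_map measurable_snd.aemeasurable]
      exact (measurable_one.indicator (hBm j)).aestronglyMeasurable
    rw [← hval]
    refine hlln _ (measurable_one.indicator (hBm j)) fun a => ?_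
    have := norm_nonneg g
    by_cases ha : a ∈ (smallOscillation g (δ j) (1 / ((j : ℝ) + 1)))ᶜ
    · rw [Set.indicator_of_mem ha, Pi.one_apply, abs_one]
      linarith
    · rw [Set.indicator_of_notMem ha, abs_zero]
      linarith
  have hgb : ∀ a, |g a| ≤ ‖g‖ + 1 := fun a => by
    have := g.norm_coe_le_norm a
    rw [Real.norm_eq_abs] at this
    linarith
  filter_upwards [hlln g g.continuous.measurable hgb, ae_all_iff.2 hfreq, hX.ae_snd_eq_forward,
    hX.fst_joint.ae_tendsto_dist_forward hY0 hinv herg hφm hφi hφ0 hφ] with x h1 h2 h3 h4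
  refine ⟨h1, tendsto_average_of_tendsto_dist (x := fun k => (x k).2) ?_ hgb h1 fun j =>
    ⟨δ j, hδ j, _, hδ' j, h2 j⟩⟩
  refine (h4 (x 0).2 u).congr fun n => ?_
  rw [← h3 n]

end Conclusion

end MIRFS

/-! ### The main theorem -/

theorem theorem1
    {𝓨 M Ω : Type*}
    -- the state space of the driving chain, a countably generated measurable space
    [MeasurableSpace 𝓨] [MeasurableSpace.CountablyGenerated 𝓨]
    -- the complete separable metric space in which the iterations live
    [MetricSpace M] [CompleteSpace M] [TopologicalSpace.SeparableSpace M]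
    [MeasurableSpace M] [BorelSpace M]
    [MeasurableSpace Ω] (Pr : Measure Ω) [IsProbabilityMeasure Pr]
    -- transition kernel, transition density, stationary law and its positive density
    (P : Kernel 𝓨 𝓨) [IsMarkovKernel P] (m : Measure 𝓨) [SigmaFinite m]
    (p : 𝓨 → 𝓨 → ℝ≥0) (hp : Measurable (Function.uncurry p))
    (hPp : ∀ y, P y = m.withDensity (fun z => (p y z : ℝ≥0∞)))
    (π : Measure 𝓨) [IsProbabilityMeasure π] (hπ : Kernel.Invariant P π)
    (q : 𝓨 → ℝ≥0) (hq : Measurable q) (hq_pos : ∀ y, 0 < q y)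
    (hπq : π = m.withDensity (fun y => (q y : ℝ≥0∞)))
    -- irreducibility, aperiodicity and Harris recurrence
    (ψ : Measure 𝓨) (hψ : MIRFS.IsMaximalIrreducibilityMeasure P ψ)
    (haper : MIRFS.IsAperiodic P ψ) (hHarris : MIRFS.IsHarrisRecurrent P)
    -- the stationary chain, the stationary dual chain, the initial value, the random maps
    (Y Yd : ℕ → Ω → 𝓨) (hY : MIRFS.IsMarkovChain P π Pr Y)
    (hYd : MIRFS.IsMarkovChain (MIRFS.dualKernel m p q) π Pr Yd)
    (M₀ : Ω → M) (hM₀ : Measurable M₀)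
    (hindep : IndepFun M₀ (fun ω n => Y n ω) Pr)
    (hindep_d : IndepFun M₀ (fun ω n => Yd n ω) Pr)
    (F : MIRFS.LipschitzSystem 𝓨 M)
    (hlog : MIRFS.NegativeMeanLog Pr (fun ω => MIRFS.lipConst (F (Y 1 ω))))
    (u₀ : M)
    (hlogp : ∫⁻ ω, ENNReal.ofReal (Real.posLog (dist (F (Y 1 ω) u₀) u₀)) ∂Pr < ∞) :
    ∃ Minf : Ω → M, Measurable Minf ∧
      -- (i) almost sure convergence of the backward iterations, to the same limit
      -- whatever the initial value
      ((∀ᵐ ω ∂Pr, Tendsto (fun n => F.backward (fun k => Yd k ω) n (M₀ ω)) atTop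
          (𝓝 (Minf ω))) ∧
        (∀ᵐ ω ∂Pr, ∀ u : M, Tendsto (fun n => F.backward (fun k => Yd k ω) n u) atTop
          (𝓝 (Minf ω)))) ∧
      -- (ii) convergence in distribution of the forward iterations
      TendstoInDistribution (fun n ω => F.forward (fun k => Y k ω) n (M₀ ω)) atTop Minf
        (fun _ => Pr) Pr ∧
      -- (iii) the law of `(Yd 1, Minf)` is the unique stationary law of `(Y n, M n)`
      (Kernel.Invariant (F.jointKernel P) (Pr.map (fun ω => (Yd 1 ω, Minf ω))) ∧
        ∀ ν : Measure (𝓨 × M), IsProbabilityMeasure ν → Kernel.Invariant (F.jointKernel P) ν →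
          ν = Pr.map (fun ω => (Yd 1 ω, Minf ω))) ∧
      -- (iv) the ergodic theorem under the stationary law of the joint chain
      (∀ (u : M) (g : M →ᵇ ℝ),
        ∀ᵐ x ∂(MIRFS.chainLaw (F.jointKernel P) (Pr.map (fun ω => (Yd 1 ω, Minf ω)))),
          Tendsto (fun n : ℕ => (n : ℝ)⁻¹ * ∑ k ∈ Finset.Icc 1 n, g (x k).2) atTop
            (𝓝 (∫ ω, g (Minf ω) ∂Pr)) ∧
          Tendsto (fun n : ℕ => (n : ℝ)⁻¹ *
              ∑ k ∈ Finset.Icc 1 n, g (F.forward (fun i => (x i).1) k u)) atTop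
            (𝓝 (∫ ω, g (Minf ω) ∂Pr))) := by
  have : SecondCountableTopology M := UniformSpace.secondCountable_of_separable M
  have hYm := hY.isMarkovSeq
  have hY0 := hY.initial.map_eq
  have hYdm := hYd.isMarkovSeq
  have hYd0 := hYd.initial.map_eq
  have hdual := MIRFS.inDuality_dualKernel hp hPp hq hq_pos hπq
  have herg := MIRFS.isErgodicKernel_of_isIrreducible hπ hψ.ne_zero hψ.irreducible
  have hY1 : Pr.map (Y 1) = π := hYm.map_eq_of_invariant hY0 hπ 1
  have hYd1 : Pr.map (Yd 1) = π := hYdm.map_eq_of_invariant hYd0 hdual.invariant 1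
  have hlip : Measurable (fun y => MIRFS.lipConst (F y)) := MIRFS.measurable_lipConst F
  have hneg : MIRFS.NegativeMeanLog π (fun y => MIRFS.lipConst (F y)) := by
    rw [MIRFS.NegativeMeanLog, ← hY1, lintegral_map (by fun_prop) (hYm.measurable 1),
      lintegral_map (by fun_prop) (hYm.measurable 1)]
    exact hlog
  obtain ⟨φ, hφm, hφi, hφ0, hφ⟩ := hneg.exists_integrable hlip (MIRFS.lipConst_lt_top F)
  have hdm : Measurable fun y => Real.posLog (dist (F y u₀) u₀) := by
    have h1 : Measurable fun y => dist (F y u₀) u₀ :=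
      (F.measurable'.comp measurable_prodMk_right).dist measurable_const
    exact measurable_const.max (Real.measurable_log.comp h1)
  have hdi : Integrable (fun y => Real.posLog (dist (F y u₀) u₀)) π := by
    refine ⟨hdm.aestronglyMeasurable, ?_⟩
    rw [hasFiniteIntegral_iff_ofReal (Eventually.of_forall fun y => Real.posLog_nonneg), ← hY1,
      lintegral_map hdm.ennreal_ofReal (hYm.measurable 1)]
    exact hlogp
  have hex : ∀ᵐ ω ∂Pr, ∃ x, ∀ u, Tendsto (fun n => F.backward (fun k => Yd k ω) n u) atTop
      (𝓝 x) := by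
    filter_upwards [hYm.ae_tendsto_average_dual_Icc hY0 hYdm hYd0 hdual hπ herg hφm hφi,
      hYm.ae_tendsto_average_dual_Icc hY0 hYdm hYd0 hdual hπ herg hdm hdi] with ω h1 h2
    exact MIRFS.LipschitzSystem.exists_tendsto_backward (y := fun k => Yd k ω) hφ hφ0 h1 h2
  have hback : ∀ (w : Ω → M), Measurable w → ∀ n,
      Measurable fun ω => F.backward (fun k => Yd k ω) n (w ω) := fun w hw n =>
    (F.measurable_backward n).comp (hYdm.measurable_path.prodMk hw)
  have hforw : ∀ (w : Ω → M), Measurable w → ∀ n,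
      Measurable fun ω => F.forward (fun k => Y k ω) n (w ω) := fun w hw n =>
    (F.measurable_forward n).comp (hYm.measurable_path.prodMk hw)
  have hlaw : ∀ (w : Ω → M), Measurable w → IndepFun w (fun ω n => Y n ω) Pr →
      IndepFun w (fun ω n => Yd n ω) Pr → ∀ n,
      Pr.map (fun ω => (Y n ω, F.forward (fun k => Y k ω) n (w ω))) =
        Pr.map (fun ω => (Yd 1 ω, F.backward (fun k => Yd k ω) n (w ω))) := fun w hw h1 h2 n =>
    MIRFS.map_forward_eq_map_backward hYm hY0 hYdm hYd0 hdual hw h1 h2 n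
  -- A deterministic start is independent of everything, so reversal holds from `u₀` as well;
  -- stationarity and uniqueness need only this start.
  have hlaw₀ := hlaw (fun _ => u₀) measurable_const (indepFun_const_left _ _)
    (indepFun_const_left _ _)
  obtain ⟨Minf, hMinf, hlim₀⟩ := measurable_limit_of_tendsto_metrizable_ae
    (fun n => (hback _ (measurable_const (a := u₀)) n).aemeasurable)
    (hex.mono fun ω ⟨x, hx⟩ => ⟨x, hx u₀⟩)
  have hall : ∀ᵐ ω ∂Pr, ∀ u, Tendsto (fun n => F.backward (fun k => Yd k ω) n u) atTop
      (𝓝 (Minf ω)) := by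
    filter_upwards [hex, hlim₀] with ω ⟨x, hx⟩ h2 u
    rw [← tendsto_nhds_unique (hx u₀) h2]
    exact hx u
  -- The exceptional null set does not depend on `u`, so the random start `M₀ ω` may be inserted
  -- pathwise.
  have hlim : ∀ᵐ ω ∂Pr, Tendsto (fun n => F.backward (fun k => Yd k ω) n (M₀ ω)) atTop
      (𝓝 (Minf ω)) := hall.mono fun ω h => h _
  have hpair : Measurable fun ω => (Yd 1 ω, Minf ω) := (hYdm.measurable 1).prodMk hMinf
  set Γ := Pr.map (fun ω => (Yd 1 ω, Minf ω)) with hΓdef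
  have hΓprob : IsProbabilityMeasure Γ := Measure.isProbabilityMeasure_map hpair.aemeasurable
  have hΓ : Kernel.Invariant (F.jointKernel P) Γ := by
    refine MIRFS.invariant_of_ae_tendsto (hYdm.measurable 1) (hback _ (measurable_const (a := u₀)))
      hMinf hlim₀ fun n => ?_
    -- Backward iterations do not evolve by the joint kernel along the dual path, but their laws,
    -- with `Yd 1`, are those of the forward pairs, which do.
    rw [← hlaw₀, ← hlaw₀]
    exact hYm.map_forward_succ u₀ n
  have huniq : ∀ ν : Measure (𝓨 × M), IsProbabilityMeasure ν →
      Kernel.Invariant (F.jointKernel P) ν → ν = Γ := by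
    intro ν _ hν
    refine MIRFS.eq_of_invariant_joint hYm hY0 hπ herg hφm hφi hφ0 hφ (fun ν' _ hν' =>
      MIRFS.eq_of_invariant_of_absolutelyContinuous hπ herg hν'
        (MIRFS.absolutelyContinuous_of_invariant hPp hq hq_pos hπq hν')) (u₀ := u₀)
      (fun f hf hf1 hfc => ?_) hν
    rw [hΓdef, lintegral_map hf hpair]
    refine (MIRFS.tendsto_lintegral_of_continuous_snd (hYdm.measurable 1)
      (hback _ (measurable_const (a := u₀))) hlim₀ hf hf1 hfc).congr fun n => ?_
    have e1 := lintegral_map (μ := Pr) hf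
      ((hYm.measurable n).prodMk (hforw _ (measurable_const (a := u₀)) n))
    have e2 := lintegral_map (μ := Pr) hf
      ((hYdm.measurable 1).prodMk (hback _ (measurable_const (a := u₀)) n))
    rw [hlaw₀ n, e2] at e1
    exact e1
  refine ⟨Minf, hMinf, ⟨hlim, hall⟩, ?_, ⟨hΓ, huniq⟩, fun u g => ?_⟩
  · have hb := tendstoInDistribution_of_ae_tendsto
      (fun n => (hback M₀ hM₀ n).aemeasurable)
      hMinf.aemeasurable hlim
    -- Convergence in distribution depends only on the individual laws, and these agree for forward
    -- and backward iterations.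
    refine ⟨fun n => (hforw M₀ hM₀ n).aemeasurable, hMinf.aemeasurable, hb.tendsto.congr fun n => ?_⟩
    have e := congrArg (Measure.map Prod.snd) (hlaw M₀ hM₀ hindep hindep_d n)
    rw [Measure.map_map measurable_snd ((hYm.measurable n).prodMk (hforw M₀ hM₀ n)),
      Measure.map_map measurable_snd ((hYdm.measurable 1).prodMk (hback M₀ hM₀ n))] at e
    exact Subtype.ext e.symm
  · have hfst : Γ.fst = π := by
      rw [hΓdef, Measure.fst_map_prodMk hMinf, hYd1]
    have hint : ∫ s, g s.2 ∂Γ = ∫ ω, g (Minf ω) ∂Pr :=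
      integral_map hpair.aemeasurable (g.continuous.measurable.comp
        measurable_snd).aestronglyMeasurable
    rw [← hint]
    exact MIRFS.ae_tendsto_average_chainLaw hπ herg hφm hφi hφ0 hφ hΓ huniq hfst u g
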